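/- Let $D_2(a:b)$ denote the following Maker–Breaker game on the edge set of the complete graph $K_n$. The players alternately claim previously unclaimed edges, Maker moving first; in each turn Maker claims $a$ edges and Breaker claims $b$ edges (or all the remaining edges, if there are fewer), until every edge has been claimed. Maker wins if the graph on the $n$ vertices formed by his edges has diameter at most $2$ (in particular, is connected); otherwise Breaker wins. A player "wins the game" if he has a winning strategy. A non-integral bias is rounded down, and $\ln$ is the natural logarithm. (i) For all sufficiently large $n$, Maker wins the game $$D_2\Bigl(2:\Bigl\lfloor \tfrac19\, n^{1/8}/(\ln n)^{3/8}\Bigr\rfloor\Bigr).$$ (ii) For every $\varepsilon>0$ there is an $n_0=n_0(\varepsilon)$ such that for all $n\ge n_0$ Breaker wins the game $$D_2\Bigl(2:\Bigl\lfloor (2+\varepsilon)\sqrt{n/\ln n}\Bigr\rfloor\Bigr).$$ -/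

import Mathlib

open Filter

/-- A legal move in a positional game with board `X`, when Maker has already taken the elements
of `M` and Breaker those of `B`: a player of bias `k` takes exactly `k` free elements of the board,
or all the free elements if fewer than `k` are left. -/
def IsLegalMove {α : Type*} [DecidableEq α] (X : Finset α) (k : ℕ) (M B S : Finset α) : Prop :=
  S ⊆ X \ (M ∪ B) ∧ S.card = min k (X \ (M ∪ B)).card

/-- `MakerWinsFrom X W a b M B`: in the `(a:b)` Maker-Breaker game on the board `X`, Maker has a
winning strategy from the position in which he owns `M`, Breaker owns `B`, and Maker is to move.
The game ends when the board is exhausted; Maker wins iff the set he owns then satisfies `W`. -/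
inductive MakerWinsFrom {α : Type*} [DecidableEq α] (X : Finset α) (W : Finset α → Prop)
    (a b : ℕ) : Finset α → Finset α → Prop
  | finish (M B : Finset α) (hfull : X \ (M ∪ B) = ∅) (hwin : W M) : MakerWinsFrom X W a b M B
  | round (M B : Finset α) (hfree : (X \ (M ∪ B)).Nonempty)
      (S : Finset α) (hS : IsLegalMove X a M B S)
      (h : ∀ T : Finset α, IsLegalMove X b (M ∪ S) B T →
        MakerWinsFrom X W a b (M ∪ S) (B ∪ T)) : MakerWinsFrom X W a b M B

/-- `BreakerWinsFrom X W a b M B`: in the same game and the same position (Maker is to move),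
Breaker has a winning strategy; `reply S` is his answer to Maker's move `S`. -/
inductive BreakerWinsFrom {α : Type*} [DecidableEq α] (X : Finset α) (W : Finset α → Prop)
    (a b : ℕ) : Finset α → Finset α → Prop
  | finish (M B : Finset α) (hfull : X \ (M ∪ B) = ∅) (hwin : ¬ W M) : BreakerWinsFrom X W a b M B
  | round (M B : Finset α) (hfree : (X \ (M ∪ B)).Nonempty)
      (reply : Finset α → Finset α)
      (hreply : ∀ S : Finset α, IsLegalMove X a M B S → IsLegalMove X b (M ∪ S) B (reply S))
      (h : ∀ S : Finset α, IsLegalMove X a M B S →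
        BreakerWinsFrom X W a b (M ∪ S) (B ∪ reply S)) : BreakerWinsFrom X W a b M B

/-- The graph on the vertex set `Fin n` with edge set `M` has diameter at most `d`
(`ediam` is `⊤` for a disconnected graph). -/
def HasDiamAtMost (n d : ℕ) (M : Finset (Sym2 (Fin n))) : Prop :=
  (SimpleGraph.fromEdgeSet (M : Set (Sym2 (Fin n)))).ediam ≤ d

/-- Maker, who starts, has a winning strategy in the `d`-diameter game `D_d(a:b)` played on the
edges of the complete graph `K_n`. -/
def MakerWinsDiameterGame (n d a b : ℕ) : Prop :=
  MakerWinsFrom (⊤ : SimpleGraph (Fin n)).edgeFinset (HasDiamAtMost n d) a b ∅ ∅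

/-- Breaker has a winning strategy in the `d`-diameter game `D_d(a:b)` played on the
edges of the complete graph `K_n`, in which Maker starts. -/
def BreakerWinsDiameterGame (n d a b : ℕ) : Prop :=
  BreakerWinsFrom (⊤ : SimpleGraph (Fin n)).edgeFinset (HasDiamAtMost n d) a b ∅ ∅

/-! Breaker's side. Fix a vertex x. Breaker takes edges at x until none is free. Maker gains 2 edges
for each b of his, so Maker then owns at most 2n/b + 2 edges and leaves most vertices y untouched.
The edge xy of such a y is Breaker's, and x, y end at distance above 2 once Breaker also owns every
edge from y to Maker's neighbours of x. These edge sets, one per y, are disjoint boxes. Maker spoils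
at most two per turn, and Breaker, keeping the rest balanced, fills one of k boxes if their average
size is at most ((b-2)/2) ln(k/2) (`breakerWinsFrom_of_boxes`). The resulting condition 2n/b ≲ (b/2)
ln n is b ≳ 2√(n/ln n).

Maker's side. Put β = b + 1 and let n < 2^l. Maker alternates a move that controls a Beck potential
with a building move. Processing a vertex x, he builds a star from x to a set N of 8βl vertices. If
Breaker owns fewer than half of the edges from y to N, any later Maker edge from y to N joins x and
y; that edge set enters a family to be hit, with weight at most 4^(-l). At most n² such sets arise,
so the potential stays below 1 and Maker finally hits them all. The at most 16β other vertices y are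
joined to x at once by paths of length two (`makerWinsFrom_of_process`).

Exceptions are this few because N lies in a set C that sends at most l Breaker edges to each
unprocessed vertex. Such a C exists while Breaker's degrees are O(β²l²), which is ensured by always
processing a vertex of largest Breaker degree (`makerWinsFrom_of_unprocessed`). Everything fits if
5000β⁴l³ ≤ n, so biases of order n^(1/4)/(ln n)^(3/4) would also be allowed. -/

section Game

/-! ### Positions and strategies in general Maker–Breaker games -/

variable {α : Type*} [DecidableEq α]

/-- Two disjoint sets of claimed elements of the board `X`. -/
def IsPosition (X M B : Finset α) : Prop := M ⊆ X ∧ B ⊆ X ∧ Disjoint M B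

theorem exists_isLegalMove_superset {X M B P : Finset α} {k : ℕ} (hP : P ⊆ X \ (M ∪ B))
    (hk : P.card ≤ k) : ∃ S, IsLegalMove X k M B S ∧ P ⊆ S := by
  obtain ⟨S, h1, h2, h3⟩ := Finset.exists_subsuperset_card_eq hP
    (le_min hk (Finset.card_le_card hP)) (min_le_right k (X \ (M ∪ B)).card)
  exact ⟨S, ⟨h2, h3⟩, h1⟩

theorem IsLegalMove.card_le {X M B S : Finset α} {k : ℕ} (h : IsLegalMove X k M B S) :
    S.card ≤ k := h.2.trans_le (min_le_left _ _)

theorem IsPosition.maker_move {X M B S : Finset α} {k : ℕ} (h : IsPosition X M B)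
    (hS : IsLegalMove X k M B S) : IsPosition X (M ∪ S) B := by
  obtain ⟨h1, h2, h3⟩ := h
  refine ⟨Finset.union_subset h1 fun e he => ?_, h2, ?_⟩
  · exact (Finset.mem_sdiff.1 (hS.1 he)).1
  · refine Finset.disjoint_union_left.2 ⟨h3, Finset.disjoint_left.2 fun e he hB => ?_⟩
    exact (Finset.mem_sdiff.1 (hS.1 he)).2 (Finset.mem_union_right _ hB)

theorem IsPosition.breaker_move {X M B T : Finset α} {k : ℕ} (h : IsPosition X M B)
    (hT : IsLegalMove X k M B T) : IsPosition X M (B ∪ T) := by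
  obtain ⟨h1, h2, h3⟩ := h
  refine ⟨h1, Finset.union_subset h2 fun e he => ?_, ?_⟩
  · exact (Finset.mem_sdiff.1 (hT.1 he)).1
  · refine Finset.disjoint_union_right.2 ⟨h3, Finset.disjoint_right.2 fun e he hB => ?_⟩
    exact (Finset.mem_sdiff.1 (hT.1 he)).2 (Finset.mem_union_left _ hB)

theorem isLegalMove_of_full {X M B S : Finset α} {k : ℕ} (h : X \ (M ∪ B) = ∅) :
    IsLegalMove X k M B S ↔ S = ∅ := by
  unfold IsLegalMove
  rw [h]
  constructor
  · rintro ⟨h, -⟩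
    exact Finset.subset_empty.1 h
  · rintro rfl
    simp

/-- On a full board both moves are empty and the position does not change, so strategies need not
check whether the game is over. -/
theorem MakerWinsFrom.of_move {X : Finset α} {W : Finset α → Prop} {a b : ℕ} {M B S : Finset α}
    (hS : IsLegalMove X a M B S)
    (h : ∀ T, IsLegalMove X b (M ∪ S) B T → MakerWinsFrom X W a b (M ∪ S) (B ∪ T)) :
    MakerWinsFrom X W a b M B := by
  rcases (X \ (M ∪ B)).eq_empty_or_nonempty with h0 | h0
  · have : S = ∅ := (isLegalMove_of_full h0).1 hS
    subst this
    have := h ∅ ((isLegalMove_of_full (by simpa using h0)).2 rfl)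
    simpa using this
  · exact .round M B h0 S hS h

/-- Breaker only names elements `P` that he wants, some of which he may already own. The rest of his
move is arbitrary, since the continuation has to cope with every larger `B'`. -/
theorem BreakerWinsFrom.of_reply {X : Finset α} {W : Finset α → Prop} {a b : ℕ} {M B : Finset α}
    (hpos : IsPosition X M B)
    (h : ∀ S, IsLegalMove X a M B S → ∃ P ⊆ X \ (M ∪ S), P.card ≤ b ∧
      ∀ B', IsPosition X (M ∪ S) B' → B ∪ P ⊆ B' → BreakerWinsFrom X W a b (M ∪ S) B') :
    BreakerWinsFrom X W a b M B := by
  have key : ∀ S, IsLegalMove X a M B S → ∃ T, IsLegalMove X b (M ∪ S) B T ∧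
      BreakerWinsFrom X W a b (M ∪ S) (B ∪ T) := by
    intro S hS
    obtain ⟨P, hP, hPb, hc⟩ := h S hS
    have h1 : P \ B ⊆ X \ ((M ∪ S) ∪ B) := by
      intro e he
      have h2 := Finset.mem_sdiff.1 he
      have h3 := Finset.mem_sdiff.1 (hP h2.1)
      simp only [Finset.mem_sdiff, Finset.mem_union] at h3 ⊢
      tauto
    obtain ⟨T, hT, hPT⟩ := exists_isLegalMove_superset h1
      ((Finset.card_le_card Finset.sdiff_subset).trans hPb)
    refine ⟨T, hT, hc _ ((hpos.maker_move hS).breaker_move hT) ?_⟩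
    intro e he
    by_cases heB : e ∈ B
    · exact Finset.mem_union_left _ heB
    · refine Finset.mem_union_right _ (hPT (Finset.mem_sdiff.2 ⟨?_, heB⟩))
      exact (Finset.mem_union.1 he).resolve_left heB
  rcases (X \ (M ∪ B)).eq_empty_or_nonempty with h0 | h0
  · obtain ⟨T, hT, hw⟩ := key ∅ ((isLegalMove_of_full h0).2 rfl)
    have : T = ∅ := (isLegalMove_of_full (by simpa using h0)).1 hT
    subst this
    simpa using hw
  · choose! r hr using key
    exact .round M B h0 r (fun S hS => (hr S hS).1) (fun S hS => (hr S hS).2)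

theorem card_free_lt {X M B M' B' S : Finset α} {k : ℕ} (hk : 0 < k)
    (h0 : (X \ (M ∪ B)).Nonempty) (hS : IsLegalMove X k M B S) (hM : M ∪ S ⊆ M') (hB : B ⊆ B') :
    (X \ (M' ∪ B')).card < (X \ (M ∪ B)).card := by
  have hSne : S.Nonempty := by
    rw [← Finset.card_pos, hS.2]
    exact lt_min hk h0.card_pos
  obtain ⟨e, he⟩ := hSne
  refine Finset.card_lt_card ⟨Finset.sdiff_subset_sdiff le_rfl
    (Finset.union_subset_union (Finset.subset_union_left.trans hM) hB), fun hsub => ?_⟩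
  exact (Finset.mem_sdiff.1 (hsub (hS.1 he))).2
    (Finset.mem_union_left _ (hM (Finset.mem_union_right _ he)))

/-- Once Breaker's elements rule out `W` for good, he plays arbitrarily to the end of the game. -/
theorem breakerWinsFrom_of_forall_not {X : Finset α} {W : Finset α → Prop} {a b : ℕ} (ha : 0 < a)
    {M B : Finset α} (hpos : IsPosition X M B)
    (h : ∀ M' B', IsPosition X M' B' → B ⊆ B' → ¬ W M') : BreakerWinsFrom X W a b M B := by
  induction hc : (X \ (M ∪ B)).card using Nat.strong_induction_on generalizing M B with
  | _ c ih =>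
    rcases (X \ (M ∪ B)).eq_empty_or_nonempty with h0 | h0
    · exact .finish M B h0 (h M B hpos le_rfl)
    · refine .of_reply hpos fun S hS => ⟨∅, by simp, by simp, fun B' hp hB => ?_⟩
      have hB' : B ⊆ B' := Finset.subset_union_left.trans hB
      exact ih _ (hc ▸ card_free_lt ha h0 hS le_rfl hB') hp
        (fun M'' B'' hp' hB'' => h M'' B'' hp' (hB'.trans hB'')) rfl

end Game

/-! ### The box game -/

section Boxes

variable {α : Type*} [DecidableEq α]

/-- Removing one element at a time from a largest set preserves balance. -/
theorem exists_balanced_subsets {ι : Type*} [DecidableEq ι] {Y : Finset ι}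
    (R : ι → Finset α) (hbal : ∀ i ∈ Y, ∀ j ∈ Y, (R i).card ≤ (R j).card + 1) (t : ℕ)
    (ht : t ≤ ∑ i ∈ Y, (R i).card) :
    ∃ R' : ι → Finset α, (∀ i, R' i ⊆ R i) ∧
      (∀ i ∈ Y, ∀ j ∈ Y, (R' i).card ≤ (R' j).card + 1) ∧
      ∑ i ∈ Y, (R' i).card + t = ∑ i ∈ Y, (R i).card := by
  induction t with
  | zero => exact ⟨R, fun _ => le_rfl, hbal, by simp⟩
  | succ t ih =>
    obtain ⟨R', h1, h2, h3⟩ := ih (by omega)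
    have hY : Y.Nonempty := by
      rw [Finset.nonempty_iff_ne_empty]
      rintro rfl
      simp at ht
    obtain ⟨i, hi, hmax⟩ := Y.exists_max_image (fun i => (R' i).card) hY
    have hpos : 0 < (R' i).card := by
      by_contra hcon
      have : ∑ j ∈ Y, (R' j).card = 0 := Finset.sum_eq_zero fun j hj => by
        have := hmax j hj
        omega
      omega
    obtain ⟨e, he⟩ := Finset.card_pos.1 hpos
    have hce : ((R' i).erase e).card + 1 = (R' i).card := Finset.card_erase_add_one he
    refine ⟨Function.update R' i ((R' i).erase e), fun j => ?_, fun j hj k hk => ?_, ?_⟩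
    · rcases eq_or_ne j i with rfl | hji
      · simpa using (Finset.erase_subset _ _).trans (h1 j)
      · simpa [hji] using h1 j
    · have := h2 j hj k hk
      have := h2 i hi k hk
      have := hmax j hj
      by_cases hji : j = i <;> by_cases hki : k = i
      · simp [hji, hki]
      · simp only [hji, Function.update_self, ne_eq, hki, not_false_eq_true,
          Function.update_of_ne]
        omega
      · simp only [hki, Function.update_self, ne_eq, hji, not_false_eq_true,
          Function.update_of_ne]
        omega
      · simpa [hji, hki]
    · have e1 : ∑ j ∈ Y, (R' j).card = (R' i).card + ∑ j ∈ Y.erase i, (R' j).card :=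
        (Finset.add_sum_erase Y (fun j => (R' j).card) hi).symm
      have e2 := (Finset.add_sum_erase Y
        (fun j => (Function.update R' i ((R' i).erase e) j).card) hi).symm
      have e3 : ∑ j ∈ Y.erase i, (Function.update R' i ((R' i).erase e) j).card =
          ∑ j ∈ Y.erase i, (R' j).card := Finset.sum_congr rfl fun j hj => by
        simp [Finset.ne_of_mem_erase hj]
      simp only [Function.update_self] at e2
      omega

/-- Breaker fills one of many disjoint boxes when Maker can spoil at most two boxes per turn. -/
theorem breakerWinsFrom_of_boxes {ι : Type*} [DecidableEq ι] {X : Finset α}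
    {W : Finset α → Prop} {b : ℕ} (hb : 2 ≤ b) (Y : Finset ι) :
    ∀ (M B : Finset α) (R : ι → Finset α), IsPosition X M B → Y.Nonempty →
      (∀ i ∈ Y, R i ⊆ X) → (∀ i ∈ Y, Disjoint (R i) M) →
      (∀ i ∈ Y, ∀ j ∈ Y, i ≠ j → Disjoint (R i) (R j)) →
      (∀ i ∈ Y, ∀ j ∈ Y, (R i).card ≤ (R j).card + 1) →
      ((∑ i ∈ Y, (R i).card : ℕ) : ℝ) ≤
        Y.card * (((b : ℝ) - 2) / 2 * Real.log ((Y.card : ℝ) / 2)) →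
      (∀ i ∈ Y, ∀ M' B', IsPosition X M' B' → B ⊆ B' → R i ⊆ B' →
        BreakerWinsFrom X W 2 b M' B') →
      BreakerWinsFrom X W 2 b M B := by
  induction hk : Y.card using Nat.strong_induction_on generalizing Y with
  | _ k ih =>
  intro M B R hpos hY hX hM hdisj hbal hsum hgoal
  subst hk
  by_cases hzero : ∑ i ∈ Y, (R i).card = 0
  · obtain ⟨i, hi⟩ := hY
    have : R i = ∅ := Finset.card_eq_zero.1 (Finset.sum_eq_zero_iff.1 hzero i hi)
    exact hgoal i hi M B hpos le_rfl (by simp [this])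
  -- With at most two boxes the logarithm is nonpositive, so the boxes would already be empty.
  have hk3 : 3 ≤ Y.card := by
    by_contra hcon
    have h1 : (Y.card : ℝ) ≤ 2 := by exact_mod_cast (by omega : Y.card ≤ 2)
    have h2 : Real.log ((Y.card : ℝ) / 2) ≤ 0 :=
      Real.log_nonpos (by positivity) (by linarith)
    have h3 : (0 : ℝ) ≤ ((b : ℝ) - 2) / 2 := by
      have : (2 : ℝ) ≤ b := by exact_mod_cast hb
      linarith
    have h4 : (Y.card : ℝ) * (((b : ℝ) - 2) / 2 * Real.log ((Y.card : ℝ) / 2)) ≤ 0 :=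
      mul_nonpos_of_nonneg_of_nonpos (by positivity) (mul_nonpos_of_nonneg_of_nonpos h3 h2)
    have h5 : (∑ i ∈ Y, (R i).card : ℕ) ≤ 0 := by exact_mod_cast hsum.trans h4
    omega
  refine .of_reply hpos fun S hS => ?_
  set H := Y.filter (fun i => ¬ Disjoint (R i) S) with hH
  have hHcard : H.card ≤ 2 := by
    refine le_trans ?_ hS.card_le
    have hch : ∀ i ∈ H, ∃ e, e ∈ R i ∧ e ∈ S := fun i hi =>
      Finset.not_disjoint_iff.1 (Finset.mem_filter.1 hi).2
    rcases S.eq_empty_or_nonempty with rfl | ⟨e0, -⟩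
    · simp [hH]
    have : Nonempty α := ⟨e0⟩
    choose! f hf using hch
    refine Finset.card_le_card_of_injOn f (fun i hi => (hf i hi).2) ?_
    intro i hi j hj hij
    by_contra hne
    have := hdisj i (Finset.mem_filter.1 hi).1 j (Finset.mem_filter.1 hj).1 hne
    exact Finset.disjoint_left.1 this (hf i hi).1 (hij ▸ (hf j hj).1)
  -- Exactly two boxes are discarded, among them all spoiled ones, so that the number of boxes drops
  -- by 2 every round.
  obtain ⟨Q, hHQ, hQY, hQ⟩ := Finset.exists_subsuperset_card_eq (Finset.filter_subset _ _ : H ⊆ Y)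
    hHcard (by omega : 2 ≤ Y.card)
  set Y' := Y \ Q with hY'
  have hY'Y : Y' ⊆ Y := Finset.sdiff_subset
  have hY'c : Y'.card = Y.card - 2 := by rw [hY', Finset.card_sdiff_of_subset hQY, hQ]
  have hY'ne : Y'.Nonempty := Finset.card_pos.1 (by omega)
  have hY'S : ∀ i ∈ Y', Disjoint (R i) (M ∪ S) := by
    intro i hi
    refine Finset.disjoint_union_right.2 ⟨hM i (hY'Y hi), ?_⟩
    by_contra hcon
    exact (Finset.mem_sdiff.1 hi).2 (hHQ (Finset.mem_filter.2 ⟨hY'Y hi, hcon⟩))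
  have hsplit : ∑ i ∈ Y', (R i).card + ∑ i ∈ Q, (R i).card = ∑ i ∈ Y, (R i).card :=
    Finset.sum_sdiff hQY
  -- By balance a discarded box holds at least the average minus one. These two lost units turn `b`
  -- into `b - 2` in the bound.
  have hQsum : 2 * ∑ i ∈ Y, (R i).card ≤ Y.card * (∑ i ∈ Q, (R i).card) + 2 * Y.card := by
    have h1 : ∀ i ∈ Q, ∑ j ∈ Y, (R j).card ≤ Y.card * ((R i).card + 1) := by
      intro i hi
      simpa using Finset.sum_le_card_nsmul Y (fun j => (R j).card) ((R i).card + 1)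
        (fun j hj => hbal j hj i (hQY hi))
    have h2 := Finset.sum_le_sum h1
    rw [Finset.sum_const, hQ, ← Finset.mul_sum, Finset.sum_add_distrib, Finset.sum_const, hQ] at h2
    simp only [smul_eq_mul] at h2
    linarith
  by_cases hsmall : ∑ i ∈ Y', (R i).card ≤ b
  · refine ⟨Y'.biUnion R, ?_, Finset.card_biUnion_le.trans hsmall, fun B' hp hB => ?_⟩
    · refine Finset.biUnion_subset.2 fun i hi e he => Finset.mem_sdiff.2 ⟨hX i (hY'Y hi) he, ?_⟩
      exact Finset.disjoint_left.1 (hY'S i hi) he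
    · obtain ⟨i, hi⟩ := hY'ne
      refine hgoal i (hY'Y hi) _ _ hp (Finset.subset_union_left.trans hB) ?_
      exact (Finset.subset_biUnion_of_mem R hi).trans (Finset.subset_union_right.trans hB)
  · obtain ⟨R', hR', hbal', hsum'⟩ := exists_balanced_subsets (Y := Y') R
      (fun i hi j hj => hbal i (hY'Y hi) j (hY'Y hj)) b (by omega)
    refine ⟨Y'.biUnion (fun i => R i \ R' i), ?_, ?_, fun B' hp hB => ?_⟩
    · refine Finset.biUnion_subset.2 fun i hi e he => Finset.mem_sdiff.2
        ⟨hX i (hY'Y hi) (Finset.mem_sdiff.1 he).1, ?_⟩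
      exact Finset.disjoint_left.1 (hY'S i hi) (Finset.mem_sdiff.1 he).1
    · refine Finset.card_biUnion_le.trans ?_
      have : ∑ i ∈ Y', (R i \ R' i).card + ∑ i ∈ Y', (R' i).card = ∑ i ∈ Y', (R i).card := by
        rw [← Finset.sum_add_distrib]
        exact Finset.sum_congr rfl fun i _ => Finset.card_sdiff_add_card_eq_card (hR' i)
      omega
    · refine ih Y'.card (by omega) Y' rfl _ _ R' hp hY'ne
        (fun i hi => (hR' i).trans (hX i (hY'Y hi)))
        (fun i hi => Finset.disjoint_of_subset_left (hR' i) (hY'S i hi))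
        (fun i hi j hj hij => Finset.disjoint_of_subset_left (hR' i)
          (Finset.disjoint_of_subset_right (hR' j) (hdisj i (hY'Y hi) j (hY'Y hj) hij)))
        hbal' ?_ ?_
      · have hkr : ((Y'.card : ℕ) : ℝ) = (Y.card : ℝ) - 2 := by
          rw [hY'c, Nat.cast_sub (by omega)]
          norm_num
        have hk3' : (3 : ℝ) ≤ Y.card := by exact_mod_cast hk3
        have hb' : (2 : ℝ) ≤ b := by exact_mod_cast hb
        rw [hkr]
        set κ : ℝ := ((Y.card : ℕ) : ℝ) with hκ
        set s : ℝ := ((∑ i ∈ Y, (R i).card : ℕ) : ℝ) with hs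
        have e1 : ((∑ i ∈ Y', (R' i).card : ℕ) : ℝ) + b + ((∑ i ∈ Q, (R i).card : ℕ) : ℝ) = s := by
          rw [hs, ← hsplit, ← hsum']
          push_cast
          ring
        have e2 : 2 * s ≤ κ * ((∑ i ∈ Q, (R i).card : ℕ) : ℝ) + 2 * κ := by
          rw [hs, hκ]
          exact_mod_cast hQsum
        -- Dropping two boxes lowers the logarithm by at most `2 / (κ - 2)`; times `(κ - 2) * (b -
        -- 2) / 2` this is `b - 2`, exactly the net progress of the round.
        have hlog : Real.log (κ / 2) ≤ Real.log ((κ - 2) / 2) + 2 / (κ - 2) := by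
          have h1 : κ / 2 = ((κ - 2) / 2) * (1 + 2 / (κ - 2)) := by
            have : κ - 2 ≠ 0 := by linarith
            field_simp
            ring
          have h2 : 0 < 2 / (κ - 2) := by
            have : 0 < κ - 2 := by linarith
            positivity
          rw [h1, Real.log_mul (by linarith) (by positivity)]
          have := Real.log_le_sub_one_of_pos (show 0 < 1 + 2 / (κ - 2) by positivity)
          linarith
        have hs1 : s / κ ≤ ((b : ℝ) - 2) / 2 * Real.log (κ / 2) := by
          rw [div_le_iff₀ (by linarith)]
          linarith
        have hs2 : s / κ ≤ ((b : ℝ) - 2) / 2 * (Real.log ((κ - 2) / 2) + 2 / (κ - 2)) :=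
          hs1.trans (mul_le_mul_of_nonneg_left hlog (by linarith))
        have hs3 := mul_le_mul_of_nonneg_left hs2 (show 0 ≤ κ - 2 by linarith)
        have h4 : (κ - 2) * (((b : ℝ) - 2) / 2 * (Real.log ((κ - 2) / 2) + 2 / (κ - 2))) =
            (κ - 2) * (((b : ℝ) - 2) / 2 * Real.log ((κ - 2) / 2)) + (b - 2) := by
          have : κ - 2 ≠ 0 := by linarith
          field_simp
        have h5 : (κ - 2) * (s / κ) = s - 2 * (s / κ) := by
          field_simp
        have h6 : 2 * (s / κ) ≤ ((∑ i ∈ Q, (R i).card : ℕ) : ℝ) + 2 := by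
          rw [← mul_div_assoc, div_le_iff₀ (by linarith)]
          linarith
        linarith
      · intro i hi M'' B'' hp' hB'' hR
        refine hgoal i (hY'Y hi) M'' B'' hp'
          ((Finset.subset_union_left.trans hB).trans hB'') fun e he => ?_
        by_cases heR : e ∈ R' i
        · exact hR heR
        · refine hB'' (hB (Finset.mem_union_right _ (Finset.mem_biUnion.2 ⟨i, hi, ?_⟩)))
          exact Finset.mem_sdiff.2 ⟨he, heR⟩

end Boxes

/-! ### Covered vertices and neighbourhoods -/

section Covered

theorem mk_right_injective {V : Type*} (y : V) : Function.Injective (fun z : V => s(y, z)) :=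
  fun _ _ h => Sym2.congr_right.1 h

variable {V : Type*} [DecidableEq V]

/-- The vertices covered by the edges in `M`. -/
def covered (M : Finset (Sym2 V)) : Finset V := M.biUnion Sym2.toFinset

theorem card_covered_le (M : Finset (Sym2 V)) : (covered M).card ≤ 2 * M.card := by
  rw [mul_comm]
  refine Finset.card_biUnion_le_card_mul _ _ _ fun e _ => ?_
  rw [Sym2.card_toFinset]
  split_ifs <;> omega

theorem not_mem_of_not_mem_covered {M : Finset (Sym2 V)} {y : V} (hy : y ∉ covered M) (z : V) :
    s(y, z) ∉ M := fun h => hy (Finset.mem_biUnion.2 ⟨_, h, by simp⟩)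

theorem mem_covered_right {M : Finset (Sym2 V)} {x y : V} (h : s(x, y) ∈ M) : y ∈ covered M :=
  Finset.mem_biUnion.2 ⟨_, h, by simp⟩

end Covered

section Neighbourhoods

variable {V : Type*} [Fintype V] [DecidableEq V]

/-- The vertices joined to `y` by an element of `B`. -/
def nbhd (B : Finset (Sym2 V)) (y : V) : Finset V := Finset.univ.filter fun z => s(y, z) ∈ B

@[simp]
theorem mem_nbhd {B : Finset (Sym2 V)} {y z : V} : z ∈ nbhd B y ↔ s(y, z) ∈ B := by
  simp [nbhd]

theorem nbhd_mono {B B' : Finset (Sym2 V)} (h : B ⊆ B') (y : V) : nbhd B y ⊆ nbhd B' y :=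
  fun _ hz => mem_nbhd.2 (h (mem_nbhd.1 hz))

theorem card_nbhd_le (B : Finset (Sym2 V)) (y : V) : (nbhd B y).card ≤ B.card :=
  Finset.card_le_card_of_injOn (fun z => s(y, z)) (fun _ hz => mem_nbhd.1 hz)
    ((mk_right_injective y).injOn)

theorem card_nbhd_le_add (B B' : Finset (Sym2 V)) (y : V) :
    (nbhd B' y).card ≤ (nbhd B y).card + (nbhd (B' \ B) y).card := by
  refine (Finset.card_le_card fun z hz => ?_).trans (Finset.card_union_le _ _)
  rw [mem_nbhd] at hz
  by_cases h : s(y, z) ∈ B <;> simp [h, hz]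

theorem sum_card_nbhd_le (T : Finset (Sym2 V)) : ∑ y, (nbhd T y).card ≤ 2 * T.card := by
  have h1 : ∑ y, (nbhd T y).card =
      ((Finset.univ : Finset (V × V)).filter fun p => s(p.1, p.2) ∈ T).card := by
    rw [Finset.card_filter, Fintype.sum_prod_type]
    refine Finset.sum_congr rfl fun y _ => ?_
    rw [nbhd, Finset.card_filter]
  rw [h1]
  refine Finset.card_le_mul_card_image_of_maps_to (t := T) (f := fun p : V × V => s(p.1, p.2))
    (fun p hp => (Finset.mem_filter.1 hp).2) 2 fun e _ => ?_
  induction e using Sym2.ind with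
  | _ x y =>
    refine (Finset.card_le_card (t := {(x, y), (y, x)}) fun p hp => ?_).trans Finset.card_le_two
    have := (Finset.mem_filter.1 hp).2
    rw [Sym2.eq_iff] at this
    simp only [Finset.mem_insert, Finset.mem_singleton, Prod.ext_iff]
    exact this

end Neighbourhoods

/-! ### Breaker's strategy -/

section BreakerSide

variable {n : ℕ}

theorem mk_mem_board {x y : Fin n} :
    s(x, y) ∈ (⊤ : SimpleGraph (Fin n)).edgeFinset ↔ x ≠ y := by
  simp

theorem not_hasDiamAtMost_two {M B : Finset (Sym2 (Fin n))} (hd : Disjoint M B) {x y : Fin n}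
    (hxy : x ≠ y) (h0 : s(x, y) ∈ B) (h : ∀ z, z ≠ x → z ≠ y → s(x, z) ∈ B ∨ s(y, z) ∈ B) :
    ¬ HasDiamAtMost n 2 M := by
  intro hdiam
  have h1 : (SimpleGraph.fromEdgeSet (M : Set (Sym2 (Fin n)))).edist x y ≤ 2 :=
    SimpleGraph.edist_le_ediam.trans hdiam
  obtain ⟨p, hp⟩ := SimpleGraph.exists_walk_of_edist_ne_top
    (ne_top_of_le_ne_top (by simp) h1)
  rw [← hp] at h1
  have h2 : p.length ≤ 2 := by exact_mod_cast h1
  match p with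
  | .nil => exact hxy rfl
  | .cons h3 .nil =>
    rw [SimpleGraph.fromEdgeSet_adj] at h3
    exact Finset.disjoint_left.1 hd (by simpa using h3.1) h0
  | .cons (v := z) h3 (.cons h4 .nil) =>
    rw [SimpleGraph.fromEdgeSet_adj] at h3 h4
    rcases h z h3.2.symm h4.2 with h5 | h5
    · exact Finset.disjoint_left.1 hd (by simpa using h3.1) h5
    · exact Finset.disjoint_left.1 hd (by simpa using h4.1) (Sym2.eq_swap ▸ h5)
  | .cons _ (.cons _ (.cons _ _)) => simp at h2

/-- Breaker takes edges at `x` until all of them are claimed. -/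
theorem breakerWinsFrom_of_exhaust_star {W : Finset (Sym2 (Fin n)) → Prop} {b : ℕ} (hb : 0 < b)
    (x : Fin n)
    (hcont : ∀ M B, IsPosition (⊤ : SimpleGraph (Fin n)).edgeFinset M B →
      (∀ z, z ≠ x → s(x, z) ∈ M ∨ s(x, z) ∈ B) → b * M.card ≤ 2 * n + 2 * b →
      BreakerWinsFrom (⊤ : SimpleGraph (Fin n)).edgeFinset W 2 b M B) :
    ∀ M B, IsPosition (⊤ : SimpleGraph (Fin n)).edgeFinset M B →
      b * M.card ≤ 2 * (nbhd B x).card →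
      BreakerWinsFrom (⊤ : SimpleGraph (Fin n)).edgeFinset W 2 b M B := by
  intro M B
  induction hk : n - (nbhd B x).card using Nat.strong_induction_on generalizing M B with
  | _ k ih =>
  intro hpos hM
  refine .of_reply hpos fun S hS => ?_
  have hle : ∀ B : Finset (Sym2 (Fin n)), (nbhd B x).card ≤ n := fun B => by
    simpa using Finset.card_le_univ (nbhd B x)
  set Fr := Finset.univ.filter (fun z => z ≠ x ∧ s(x, z) ∉ M ∪ S ∧ s(x, z) ∉ B) with hFr
  have hMS : b * (M ∪ S).card ≤ b * M.card + 2 * b := by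
    have := (Finset.card_union_le M S).trans (Nat.add_le_add_left hS.card_le _)
    nlinarith
  have hsub : ∀ Z ⊆ Fr, Z.image (fun z => s(x, z)) ⊆
      (⊤ : SimpleGraph (Fin n)).edgeFinset \ (M ∪ S) := by
    intro Z hZ
    refine Finset.image_subset_iff.2 fun z hz => Finset.mem_sdiff.2 ?_
    have := (Finset.mem_filter.1 (hZ hz)).2
    exact ⟨mk_mem_board.2 this.1.symm, this.2.1⟩
  -- In the last round Breaker may gain fewer than `b` edges at `x` while Maker gains two; this is
  -- the extra `2 * b` in the bound.
  by_cases hsmall : Fr.card ≤ b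
  · refine ⟨Fr.image (fun z => s(x, z)), hsub _ le_rfl, Finset.card_image_le.trans hsmall,
      fun B' hp hB => hcont _ _ hp (fun z hz => ?_) ?_⟩
    · by_contra hcon
      rw [not_or] at hcon
      have hzB : s(x, z) ∉ B := fun h => hcon.2 (hB (Finset.mem_union_left _ h))
      exact hcon.2 (hB (Finset.mem_union_right _ (Finset.mem_image_of_mem _
        (Finset.mem_filter.2 ⟨Finset.mem_univ _, hz, hcon.1, hzB⟩))))
    · have := hle B
      omega
  · obtain ⟨Z, hZ, hZb⟩ := Finset.exists_subset_card_eq (by omega : b ≤ Fr.card)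
    refine ⟨Z.image (fun z => s(x, z)), hsub Z hZ, Finset.card_image_le.trans hZb.le,
      fun B' hp hB => ?_⟩
    have hcard : (nbhd B x).card + b ≤ (nbhd B' x).card := by
      rw [← hZb, ← Finset.card_union_of_disjoint]
      · refine Finset.card_le_card (Finset.union_subset
          (nbhd_mono (Finset.subset_union_left.trans hB) x) fun z hz => mem_nbhd.2 ?_)
        exact hB (Finset.mem_union_right _ (Finset.mem_image_of_mem _ hz))
      · refine Finset.disjoint_left.2 fun z hz hz' => ?_
        exact (Finset.mem_filter.1 (hZ hz')).2.2.2 (mem_nbhd.1 hz)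
    have := hle B'
    exact ih _ (by omega) _ _ rfl hp (by omega)

/-- Here `m` is the number of Maker's edges when the star at x is exhausted. It bounds the size of
the boxes, and at least `n - 1 - 2 * m` boxes are available. -/
theorem breakerWinsDiameterGame_two_of_bound {b : ℕ} (hn : 0 < n) (hb : 2 ≤ b)
    (h : ∀ m : ℕ, b * m ≤ 2 * n + 2 * b → 2 * m + 1 < n ∧
      (m : ℝ) ≤ ((b : ℝ) - 2) / 2 * Real.log (((n : ℝ) - 1 - 2 * m) / 2)) :
    BreakerWinsDiameterGame n 2 2 b := by
  set x : Fin n := ⟨0, hn⟩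
  refine breakerWinsFrom_of_exhaust_star (by omega) x (fun M B hpos hx hM => ?_) ∅ ∅
    ⟨by simp, by simp, by simp⟩ (by simp)
  obtain ⟨h1, h2⟩ := h _ hM
  set Y : Finset (Fin n) := Finset.univ \ insert x (covered M) with hY
  have hYx : ∀ y ∈ Y, y ≠ x := by
    rintro y hy rfl
    simp [hY] at hy
  have hYM : ∀ y ∈ Y, y ∉ covered M := by
    intro y hy
    simp only [hY, Finset.mem_sdiff, Finset.mem_insert, not_or] at hy
    exact hy.2.2
  have hYcard : n ≤ Y.card + 1 + 2 * M.card := by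
    have e1 := Finset.card_sdiff_add_card_eq_card (Finset.subset_univ (insert x (covered M)))
    rw [← hY] at e1
    have e2 := Finset.card_insert_le x (covered M)
    have e3 := card_covered_le M
    simp only [Finset.card_univ, Fintype.card_fin] at e1
    omega
  have hNcov : ∀ z ∈ nbhd M x, z ∈ covered M := fun z hz => mem_covered_right (mem_nbhd.1 hz)
  have hRcard : ∀ y : Fin n, ((nbhd M x).image fun z => s(y, z)).card = (nbhd M x).card :=
    fun y => Finset.card_image_of_injective _ (mk_right_injective y)
  -- The box of `y` may contain edges that Breaker already owns; counting them as still to be taken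
  -- does no harm.
  refine breakerWinsFrom_of_boxes hb Y M B (fun y => (nbhd M x).image fun z => s(y, z)) hpos
    (Finset.card_pos.1 (by omega)) ?_ ?_ ?_ ?_ ?_ ?_
  · intro y hy
    refine Finset.image_subset_iff.2 fun z hz => mk_mem_board.2 ?_
    rintro rfl
    exact hYM _ hy (hNcov _ hz)
  · intro y hy
    refine Finset.disjoint_left.2 fun e he => ?_
    obtain ⟨z, -, rfl⟩ := Finset.mem_image.1 he
    exact not_mem_of_not_mem_covered (hYM y hy) z
  -- Of the two ends of an edge in a box, only one is uncovered by Maker, so the edge determines its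
  -- box.
  · intro y hy y' hy' hne
    refine Finset.disjoint_left.2 fun e he he' => ?_
    obtain ⟨z, hz, rfl⟩ := Finset.mem_image.1 he
    obtain ⟨z', hz', heq⟩ := Finset.mem_image.1 he'
    rw [Sym2.eq_iff] at heq
    rcases heq with heq | heq
    · exact hne heq.1.symm
    · exact hYM _ hy' (heq.1 ▸ hNcov _ hz)
  · intro y _ y' _
    simp only [hRcard]
    omega
  · simp only [hRcard, Finset.sum_const, smul_eq_mul, Nat.cast_mul]
    refine mul_le_mul_of_nonneg_left ?_ (by positivity)
    have e1 : ((nbhd M x).card : ℝ) ≤ M.card := by exact_mod_cast card_nbhd_le M x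
    refine (e1.trans h2).trans (mul_le_mul_of_nonneg_left ?_ ?_)
    · have e2 : (n : ℝ) ≤ Y.card + 1 + 2 * M.card := by exact_mod_cast hYcard
      have e3 : 2 * (M.card : ℝ) + 1 < n := by exact_mod_cast h1
      exact Real.log_le_log (by linarith) (by linarith)
    · have : (2 : ℝ) ≤ b := by exact_mod_cast hb
      linarith
  · intro y hy M' B' hp' hB hR
    refine breakerWinsFrom_of_forall_not (by norm_num) hp' fun M'' B'' hp'' hB'' => ?_
    have hfree : ∀ z, z ≠ x → s(x, z) ∉ M → s(x, z) ∈ B'' := fun z hz hzM =>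
      hB'' (hB ((hx z hz).resolve_left hzM))
    refine not_hasDiamAtMost_two hp''.2.2 (hYx y hy).symm
      (hfree y (hYx y hy) fun hM => hYM y hy (mem_covered_right hM)) fun z hzx _ => ?_
    by_cases hz : s(x, z) ∈ M
    · exact Or.inr (hB'' (hR (Finset.mem_image_of_mem _ (mem_nbhd.2 hz))))
    · exact Or.inl (hfree z hzx hz)

theorem eventually_breakerWinsDiameterGame_two {ε : ℝ} (hε : 0 < ε) :
    ∀ᶠ n : ℕ in atTop, BreakerWinsDiameterGame n 2 2
      ⌊(2 + ε) * Real.sqrt ((n : ℝ) / Real.log (n : ℝ))⌋₊ := by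
  have hlog : Tendsto (fun n : ℕ => Real.log (n : ℝ)) atTop atTop :=
    Real.tendsto_log_atTop.comp tendsto_natCast_atTop_atTop
  have hdiv : Tendsto (fun n : ℕ => (n : ℝ) / Real.log (n : ℝ)) atTop atTop := by
    have h1 : Tendsto (fun x : ℝ => x / Real.log x) atTop atTop := by
      have := Real.isLittleO_log_id_atTop.tendsto_div_nhds_zero
      have h2 : Tendsto (fun x : ℝ => Real.log x / x) atTop (nhdsWithin 0 (Set.Ioi 0)) := by
        refine tendsto_nhdsWithin_iff.2 ⟨this, ?_⟩
        filter_upwards [eventually_gt_atTop 1] with x hx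
        exact div_pos (Real.log_pos hx) (by linarith)
      refine (tendsto_inv_nhdsGT_zero.comp h2).congr fun x => ?_
      simp [inv_div]
    exact h1.comp tendsto_natCast_atTop_atTop
  have hsqrt := Real.tendsto_sqrt_atTop.comp hdiv
  filter_upwards [eventually_ge_atTop 100, hlog.eventually_ge_atTop (6 * (4 + 2 * ε) / (2 * ε) + 6),
    hsqrt.eventually_ge_atTop (6 / ε + 20)] with n hn hL hu
  simp only [Function.comp_apply] at hu
  set L := Real.log (n : ℝ) with hLdef
  set u := Real.sqrt ((n : ℝ) / L) with hudef
  set b := ⌊(2 + ε) * u⌋₊ with hbdef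
  have hn' : (100 : ℝ) ≤ n := by exact_mod_cast hn
  have hL6 : 6 < L := lt_of_lt_of_le (by
    have : 0 < 6 * (4 + 2 * ε) / (2 * ε) := by positivity
    linarith) hL
  have hu2 : u ^ 2 * L = n := by
    rw [hudef, Real.sq_sqrt (by positivity)]
    field_simp
  have hu20 : 20 ≤ u := by
    have : 0 < 6 / ε := by positivity
    linarith
  have huε : 6 ≤ ε * u := by
    have h1 := mul_le_mul_of_nonneg_left hu hε.le
    have h2 : ε * (6 / ε + 20) = 6 + 20 * ε := by field_simp
    linarith
  have hb : (2 + ε) * u < b + 1 := Nat.lt_floor_add_one _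
  have hbu : (2 + ε / 2) * u ≤ (b : ℝ) - 2 := by nlinarith
  have hb42 : (42 : ℝ) ≤ b := by nlinarith
  -- Of the 6 subtracted from `L`, 2 pays for replacing `n` by `n / 4` in the logarithm and 4
  -- absorbs the `2 * b` in the bound on `m`. The slack from `ε` outweighs it for large `L`.
  have hmain : 4 * (n : ℝ) ≤ b * (b - 2) * (L - 6) := by
    have h1 : (2 + ε / 2) * u * ((2 + ε / 2) * u) ≤ b * (b - 2) :=
      mul_le_mul (by linarith) hbu (by positivity) (by linarith)
    have h2 := mul_le_mul_of_nonneg_right h1 (show 0 ≤ L - 6 by linarith)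
    have h3 : 6 * (4 + 2 * ε) ≤ 2 * ε * (L - 6) := by
      have := mul_le_mul_of_nonneg_left hL (show 0 ≤ 2 * ε by positivity)
      have h4 : 2 * ε * (6 * (4 + 2 * ε) / (2 * ε) + 6) = 6 * (4 + 2 * ε) + 12 * ε := by
        field_simp
        ring
      linarith
    have h5 : 4 * L ≤ (4 + 2 * ε) * (L - 6) := by linarith
    have h6 : (4 + 2 * ε) * (L - 6) ≤ (2 + ε / 2) * (2 + ε / 2) * (L - 6) :=
      mul_le_mul_of_nonneg_right (by nlinarith) (by linarith)
    have h7 := mul_le_mul_of_nonneg_left (h5.trans h6) (sq_nonneg u)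
    nlinarith
  refine breakerWinsDiameterGame_two_of_bound (by omega)
    (by exact_mod_cast (by linarith : (2 : ℝ) ≤ b)) fun m hm => ?_
  have hm' : (b : ℝ) * m ≤ 2 * n + 2 * b := by exact_mod_cast hm
  have hmn : 2 * (m : ℝ) + 1 ≤ n / 2 := by
    have h1 : (b : ℝ) * (m - 2) ≤ 2 * n := by linarith
    by_cases hm2 : (m : ℝ) ≤ 2
    · linarith
    · have h2 : 42 * ((m : ℝ) - 2) ≤ b * (m - 2) :=
        mul_le_mul_of_nonneg_right hb42 (by linarith)
      linarith
  refine ⟨by exact_mod_cast (by linarith : 2 * (m : ℝ) + 1 < n), ?_⟩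
  have hlogle : L - 2 ≤ Real.log (((n : ℝ) - 1 - 2 * m) / 2) := by
    have h1 : Real.log ((n : ℝ) / 4) ≤ Real.log (((n : ℝ) - 1 - 2 * m) / 2) :=
      Real.log_le_log (by linarith) (by linarith)
    have h2 : Real.log ((n : ℝ) / 4) = L - Real.log 4 :=
      Real.log_div (by linarith) (by norm_num)
    have h3 : Real.log 4 ≤ 2 := by
      have : (4 : ℝ) = 2 ^ 2 := by norm_num
      rw [this, Real.log_pow]
      have := Real.log_two_lt_d9
      norm_num
      linarith
    linarith
  refine le_trans ?_ (mul_le_mul_of_nonneg_left hlogle (by linarith))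
  refine le_of_mul_le_mul_left (hm'.trans ?_) (by linarith : (0 : ℝ) < b)
  nlinarith

end BreakerSide

/-! ### Beck's potential for hitting sets -/

section Hitting

variable {α : Type*} [DecidableEq α]

/-- By convexity, 2^t lies below its chord on [0, 1]. -/
theorem two_rpow_div_le {j K : ℕ} (h : j ≤ K) : (2 : ℝ) ^ ((j : ℝ) / K) ≤ 1 + (j : ℝ) / K := by
  have h1 : (j : ℝ) / K ≤ 1 := div_le_one_of_le₀ (by exact_mod_cast h) (by positivity)
  have := rpow_one_add_le_one_add_mul_self (s := 1) (by norm_num)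
    (show (0 : ℝ) ≤ (j : ℝ) / K by positivity) h1
  rw [show (2 : ℝ) = 1 + 1 by norm_num]
  simpa using this

/-- The weight of `A` when the elements of `B` are lost: halved for every `K` elements left. -/
noncomputable def hitWeight (K : ℕ) (B A : Finset α) : ℝ :=
  (2 : ℝ) ^ (-(((A \ B).card : ℝ) / K))

theorem hitWeight_pos (K : ℕ) (B A : Finset α) : 0 < hitWeight K B A :=
  Real.rpow_pos_of_pos (by norm_num) _

theorem hitWeight_le {K : ℕ} {B B' A : Finset α} (hB : B ⊆ B') (hT : (B' \ B).card ≤ K) :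
    hitWeight K B' A ≤ hitWeight K B A * (1 + ((A ∩ (B' \ B)).card : ℝ) / K) := by
  have h1 : (A \ B').card + (A ∩ (B' \ B)).card = (A \ B).card := by
    rw [← Finset.card_union_of_disjoint]
    · congr 1
      ext e
      have := @hB e
      simp only [Finset.mem_union, Finset.mem_sdiff, Finset.mem_inter]
      tauto
    · refine Finset.disjoint_left.2 fun e he he' => ?_
      simp only [Finset.mem_sdiff, Finset.mem_inter] at he he'
      exact he.2 he'.2.1
  have h2 : (A ∩ (B' \ B)).card ≤ K := (Finset.card_le_card Finset.inter_subset_right).trans hT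
  refine le_trans (le_of_eq ?_) (mul_le_mul_of_nonneg_left (two_rpow_div_le h2)
    (hitWeight_pos K B A).le)
  rw [hitWeight, hitWeight, ← Real.rpow_add (by norm_num), ← h1]
  congr 1
  push_cast
  ring

/-- Beck's potential of the sets in `F` that Maker, who owns `M`, has not hit yet. -/
noncomputable def hitPotential (K : ℕ) (F : Finset (Finset α)) (M B : Finset α) : ℝ :=
  ∑ A ∈ F.filter (fun A => Disjoint A M), hitWeight K B A

theorem hitPotential_union_le (K : ℕ) (F G : Finset (Finset α)) (M B : Finset α) :
    hitPotential K (F ∪ G) M B ≤ hitPotential K F M B + ∑ A ∈ G, hitWeight K B A := by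
  unfold hitPotential
  rw [Finset.filter_union]
  have h1 := Finset.sum_union_inter (s₁ := F.filter (fun A => Disjoint A M))
    (s₂ := G.filter (fun A => Disjoint A M)) (f := hitWeight K B)
  have h2 : 0 ≤ ∑ A ∈ F.filter (fun A => Disjoint A M) ∩ G.filter (fun A => Disjoint A M),
      hitWeight K B A := Finset.sum_nonneg fun A _ => (hitWeight_pos K B A).le
  have h3 : ∑ A ∈ G.filter (fun A => Disjoint A M), hitWeight K B A ≤ ∑ A ∈ G, hitWeight K B A :=
    Finset.sum_le_sum_of_subset_of_nonneg (Finset.filter_subset _ _)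
      fun A _ _ => (hitWeight_pos K B A).le
  linarith

/-- A move of Maker after which the potential cannot exceed its present value until Breaker
has taken more than `K` further elements. -/
theorem exists_hitting_move {X M B : Finset α} {K : ℕ} (hK : 0 < K) (F : Finset (Finset α))
    (hpos : IsPosition X M B) :
    ∃ S, IsLegalMove X 2 M B S ∧ ∀ M' B', IsPosition X M' B' → M ∪ S ⊆ M' → B ⊆ B' →
      (B' \ B).card ≤ K → hitPotential K F M' B' ≤ hitPotential K F M B := by
  rcases (X \ (M ∪ B)).eq_empty_or_nonempty with h0 | h0
  · refine ⟨∅, (isLegalMove_of_full h0).2 rfl, fun M' B' hp hM hB _ => ?_⟩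
    have hBB : B' = B := by
      refine (Finset.Subset.antisymm hB fun e he => ?_).symm
      by_contra hcon
      have : e ∈ X \ (M ∪ B) := by
        refine Finset.mem_sdiff.2 ⟨hp.2.1 he, fun hh => ?_⟩
        rcases Finset.mem_union.1 hh with hh | hh
        · exact Finset.disjoint_left.1 hp.2.2 (hM (Finset.mem_union_left _ hh)) he
        · exact hcon hh
      simp [h0] at this
    subst hBB
    refine Finset.sum_le_sum_of_subset_of_nonneg (fun A hA => ?_)
      fun A _ _ => (hitWeight_pos K _ A).le
    rw [Finset.mem_filter] at hA ⊢
    exact ⟨hA.1, Finset.disjoint_of_subset_right (Finset.subset_union_left.trans hM) hA.2⟩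
  · set G := F.filter (fun A => Disjoint A M) with hG
    -- Maker takes a free element of largest weighted degree; the second element of his move is not
    -- used.
    obtain ⟨e, he, hmax⟩ := (X \ (M ∪ B)).exists_max_image
      (fun f => ∑ A ∈ G.filter (fun A => f ∈ A), hitWeight K B A) h0
    obtain ⟨S, hS, heS⟩ := exists_isLegalMove_superset (P := {e}) (k := 2)
      (Finset.singleton_subset_iff.2 he) (by simp)
    refine ⟨S, hS, fun M' B' hp hM hB hT => ?_⟩
    set T := B' \ B with hTdef
    set δ := ∑ A ∈ G.filter (fun A => e ∈ A), hitWeight K B A with hδ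
    have hδ0 : 0 ≤ δ := Finset.sum_nonneg fun A _ => (hitWeight_pos K B A).le
    have hsub : F.filter (fun A => Disjoint A M') ⊆ G.filter (fun A => e ∉ A) := by
      intro A hA
      simp only [hG, Finset.mem_filter] at hA ⊢
      refine ⟨⟨hA.1, Finset.disjoint_of_subset_right
        (Finset.subset_union_left.trans hM) hA.2⟩, fun heA => ?_⟩
      exact Finset.disjoint_left.1 hA.2 heA (hM (Finset.mem_union_right _
        (heS (Finset.mem_singleton_self e))))
    have h1 : hitPotential K F M' B' ≤
        ∑ A ∈ G.filter (fun A => e ∉ A), hitWeight K B A * (1 + ((A ∩ T).card : ℝ) / K) :=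
      (Finset.sum_le_sum fun A _ => hitWeight_le hB hT).trans
        (Finset.sum_le_sum_of_subset_of_nonneg hsub fun A _ _ =>
          mul_nonneg (hitWeight_pos K B A).le (by positivity))
    have h2 : ∑ A ∈ G.filter (fun A => e ∉ A), hitWeight K B A * (1 + ((A ∩ T).card : ℝ) / K) =
        ∑ A ∈ G.filter (fun A => e ∉ A), hitWeight K B A +
        (∑ A ∈ G.filter (fun A => e ∉ A), hitWeight K B A * (A ∩ T).card) / K := by
      rw [Finset.sum_div, ← Finset.sum_add_distrib]
      exact Finset.sum_congr rfl fun A _ => by ring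
    have h3 : ∑ A ∈ G.filter (fun A => e ∈ A), hitWeight K B A +
        ∑ A ∈ G.filter (fun A => e ∉ A), hitWeight K B A = hitPotential K F M B :=
      Finset.sum_filter_add_sum_filter_not _ _ _
    have h4 : ∑ A ∈ G.filter (fun A => e ∉ A), hitWeight K B A * (A ∩ T).card ≤ T.card * δ := by
      calc ∑ A ∈ G.filter (fun A => e ∉ A), hitWeight K B A * (A ∩ T).card
          ≤ ∑ A ∈ G, hitWeight K B A * (A ∩ T).card :=
            Finset.sum_le_sum_of_subset_of_nonneg (Finset.filter_subset _ _) fun A _ _ =>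
              mul_nonneg (hitWeight_pos K B A).le (by positivity)
        _ = ∑ A ∈ G, ∑ f ∈ T, if f ∈ A then hitWeight K B A else 0 := by
            refine Finset.sum_congr rfl fun A _ => ?_
            rw [← Finset.sum_filter, Finset.sum_const, nsmul_eq_mul, mul_comm,
              Finset.filter_mem_eq_inter, Finset.inter_comm]
        _ = ∑ f ∈ T, ∑ A ∈ G.filter (fun A => f ∈ A), hitWeight K B A := by
            rw [Finset.sum_comm]
            exact Finset.sum_congr rfl fun f _ => (Finset.sum_filter _ _).symm
        _ ≤ ∑ f ∈ T, δ := by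
            refine Finset.sum_le_sum fun f hf => hmax f ?_
            have hf' := Finset.mem_sdiff.1 hf
            refine Finset.mem_sdiff.2 ⟨hp.2.1 hf'.1, fun hh => ?_⟩
            rcases Finset.mem_union.1 hh with hh | hh
            · exact Finset.disjoint_left.1 hp.2.2 (hM (Finset.mem_union_left _ hh)) hf'.1
            · exact hf'.2 hh
        _ = T.card * δ := by simp
    have hKr : (0 : ℝ) < K := by exact_mod_cast hK
    -- Each of Breaker's at most `K` elements adds at most `δ / K`, by maximality of `e`. The total
    -- `δ` is what Maker removed by taking `e`.
    have h5 : (∑ A ∈ G.filter (fun A => e ∉ A), hitWeight K B A * (A ∩ T).card) / K ≤ δ := by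
      rw [div_le_iff₀ hKr]
      have : (T.card : ℝ) ≤ K := by exact_mod_cast hT
      nlinarith
    linarith

theorem card_sdiff_le_add {B B₁ B₂ : Finset α} {i j : ℕ} (h1 : (B₁ \ B).card ≤ i)
    (h2 : (B₂ \ B₁).card ≤ j) : (B₂ \ B).card ≤ i + j := by
  refine (Finset.card_le_card fun e he => ?_).trans
    ((Finset.card_union_le (B₁ \ B) (B₂ \ B₁)).trans (add_le_add h1 h2))
  simp only [Finset.mem_union, Finset.mem_sdiff] at he ⊢
  tauto

theorem IsLegalMove.card_union_sdiff_le {X M B T : Finset α} {k l : ℕ} (h : IsLegalMove X k M B T)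
    (hkl : k ≤ l) : ((B ∪ T) \ B).card ≤ l := by
  rw [Finset.union_sdiff_left]
  exact ((Finset.card_le_card Finset.sdiff_subset).trans h.card_le).trans hkl

/-- Two rounds: in the first, Maker keeps the potential under control; in the second, he takes
two prescribed elements not owned by Breaker. -/
theorem makerWinsFrom_of_two_rounds {X : Finset α} {W : Finset α → Prop} {b β : ℕ} (hβ : 0 < β)
    (hbβ : b ≤ β) (F : Finset (Finset α)) {M B : Finset α} (hpos : IsPosition X M B)
    (h : ∀ M₁ B₁, IsPosition X M₁ B₁ → M ⊆ M₁ → B ⊆ B₁ → (B₁ \ B).card ≤ β →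
      ∃ P ⊆ X \ B₁, P.card ≤ 2 ∧ ∀ M₂ B₂, IsPosition X M₂ B₂ → M₁ ∪ P ⊆ M₂ → B₁ ⊆ B₂ →
        (B₂ \ B).card ≤ 2 * β → hitPotential (2 * β) F M₂ B₂ ≤ hitPotential (2 * β) F M B →
        MakerWinsFrom X W 2 b M₂ B₂) :
    MakerWinsFrom X W 2 b M B := by
  -- The factor 2 in `K` is there because Breaker moves twice before Maker's next hitting move.
  obtain ⟨S, hS, hpot⟩ := exists_hitting_move (K := 2 * β) (by omega) F hpos
  refine .of_move hS fun T hT => ?_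
  have hpos1 := (hpos.maker_move hS).breaker_move hT
  have hc1 := hT.card_union_sdiff_le hbβ
  obtain ⟨P, hP, hP2, hcont⟩ := h _ _ hpos1 Finset.subset_union_left Finset.subset_union_left hc1
  have hP' : P \ (M ∪ S) ⊆ X \ ((M ∪ S) ∪ (B ∪ T)) := by
    intro e he
    have h1 := Finset.mem_sdiff.1 he
    have h2 := Finset.mem_sdiff.1 (hP h1.1)
    refine Finset.mem_sdiff.2 ⟨h2.1, fun hh => ?_⟩
    exact (Finset.mem_union.1 hh).elim h1.2 h2.2
  obtain ⟨S', hS', hPS⟩ := exists_isLegalMove_superset hP'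
    ((Finset.card_le_card Finset.sdiff_subset).trans hP2)
  refine .of_move hS' fun T' hT' => ?_
  have hpos2 := (hpos1.maker_move hS').breaker_move hT'
  have hc2 : ((B ∪ T ∪ T') \ B).card ≤ 2 * β := by
    have := card_sdiff_le_add hc1 (hT'.card_union_sdiff_le hbβ)
    omega
  refine hcont _ _ hpos2 (fun e he => ?_) Finset.subset_union_left hc2
    (hpot _ _ hpos2 Finset.subset_union_left
      (Finset.subset_union_left.trans Finset.subset_union_left) hc2)
  by_cases heM : e ∈ M ∪ S
  · exact Finset.mem_union_left _ heM
  · refine Finset.mem_union_right _ (hPS (Finset.mem_sdiff.2 ⟨?_, heM⟩))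
    exact (Finset.mem_union.1 he).resolve_left heM

/-- Beck's criterion: Maker hits every set of `F`. -/
theorem makerWinsFrom_of_hitPotential_lt_one {X : Finset α} {W : Finset α → Prop} {b K : ℕ}
    (hK : 0 < K) (hbK : b ≤ K) (F : Finset (Finset α)) {M B : Finset α}
    (hpos : IsPosition X M B) (hlt : hitPotential K F M B < 1)
    (hF : ∀ A ∈ F, A ⊆ X)
    (hW : ∀ M', M ⊆ M' → M' ⊆ X → (∀ A ∈ F, ¬ Disjoint A M') → W M') :
    MakerWinsFrom X W 2 b M B := by
  induction hc : (X \ (M ∪ B)).card using Nat.strong_induction_on generalizing M B with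
  | _ c ih =>
    rcases (X \ (M ∪ B)).eq_empty_or_nonempty with h0 | h0
    · refine .finish M B h0 (hW M le_rfl hpos.1 fun A hA hdisj => ?_)
      -- On a full board a set missed by Maker lies inside Breaker's and has weight 1, too much for
      -- the potential.
      have hAB : A \ B = ∅ := by
        refine Finset.eq_empty_of_forall_notMem fun e he => ?_
        have he' := Finset.mem_sdiff.1 he
        have : e ∈ X \ (M ∪ B) := by
          refine Finset.mem_sdiff.2 ⟨hF A hA he'.1, fun hh => ?_⟩
          exact (Finset.mem_union.1 hh).elim (Finset.disjoint_left.1 hdisj he'.1) he'.2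
        simp [h0] at this
      have h1 : hitWeight K B A = 1 := by simp [hitWeight, hAB]
      have h2 : hitWeight K B A ≤ hitPotential K F M B :=
        Finset.single_le_sum (f := hitWeight K B) (fun A _ => (hitWeight_pos K B A).le)
          (Finset.mem_filter.2 ⟨hA, hdisj⟩)
      linarith
    · obtain ⟨S, hS, hpot⟩ := exists_hitting_move hK F hpos
      refine .of_move hS fun T hT => ?_
      have hp := (hpos.maker_move hS).breaker_move hT
      refine ih _ (hc ▸ card_free_lt (by norm_num) h0 hS le_rfl Finset.subset_union_left) hp
        ((hpot _ _ hp le_rfl Finset.subset_union_left (hT.card_union_sdiff_le hbK)).trans_lt hlt)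
        (fun M' hM' => hW M' (Finset.subset_union_left.trans hM')) rfl

end Hitting

/-! ### Greedy choice of a well-spread vertex set -/

section Spread

/-- A greedy choice of `m` elements of `Z` that meets no set `S i` too often. -/
theorem exists_spread_subset {V ι : Type*} [DecidableEq V] (I : Finset ι) (S : ι → Finset V)
    {D h₀ : ℕ} (hS : ∀ i ∈ I, (S i).card ≤ D) (hh : 0 < h₀) (Z : Finset V) (m : ℕ)
    (hZ : h₀ + m ≤ Z.card) :
    ∃ C ⊆ Z, C.card = m ∧
      ∑ i ∈ I, (2 : ℝ) ^ (C ∩ S i).card ≤ I.card * (1 + (D : ℝ) / h₀) ^ m := by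
  induction m with
  | zero => exact ⟨∅, by simp, by simp, by simp⟩
  | succ m ih =>
    obtain ⟨C, hCZ, hC, hsum⟩ := ih (by omega)
    have hcard : h₀ ≤ (Z \ C).card := by
      rw [Finset.card_sdiff_of_subset hCZ]
      omega
    have hh' : (0 : ℝ) < h₀ := by exact_mod_cast hh
    set Φ := ∑ i ∈ I, (2 : ℝ) ^ (C ∩ S i).card with hΦ
    have hΦ0 : 0 ≤ Φ := Finset.sum_nonneg fun i _ => by positivity
    -- Summed over all candidates `z`, the increments of `Φ` amount to at most `D * Φ`, so some `z`
    -- increases it by at most `D * Φ / h₀`.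
    have htot : ∑ z ∈ Z \ C, ∑ i ∈ I.filter (fun i => z ∈ S i), (2 : ℝ) ^ (C ∩ S i).card ≤
        ∑ z ∈ Z \ C, D * Φ / h₀ := by
      calc ∑ z ∈ Z \ C, ∑ i ∈ I.filter (fun i => z ∈ S i), (2 : ℝ) ^ (C ∩ S i).card
          = ∑ i ∈ I, ∑ z ∈ (Z \ C).filter (fun z => z ∈ S i), (2 : ℝ) ^ (C ∩ S i).card := by
            simp only [Finset.sum_filter]
            exact Finset.sum_comm
        _ ≤ ∑ i ∈ I, (D : ℝ) * (2 : ℝ) ^ (C ∩ S i).card := by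
            refine Finset.sum_le_sum fun i hi => ?_
            rw [Finset.sum_const, nsmul_eq_mul]
            refine mul_le_mul_of_nonneg_right ?_ (by positivity)
            have : ((Z \ C).filter (fun z => z ∈ S i)).card ≤ D :=
              (Finset.card_le_card fun z hz => (Finset.mem_filter.1 hz).2).trans (hS i hi)
            exact_mod_cast this
        _ = D * Φ := by rw [hΦ, Finset.mul_sum]
        _ ≤ ∑ z ∈ Z \ C, D * Φ / h₀ := by
            rw [Finset.sum_const, nsmul_eq_mul, mul_div_assoc', le_div_iff₀ hh', mul_comm]
            refine mul_le_mul_of_nonneg_right ?_ (by positivity)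
            exact_mod_cast hcard
    obtain ⟨z, hz, hle⟩ := Finset.exists_le_of_sum_le (Finset.card_pos.1 (by omega)) htot
    have hzC := (Finset.mem_sdiff.1 hz).2
    refine ⟨insert z C, Finset.insert_subset (Finset.mem_sdiff.1 hz).1 hCZ,
      by rw [Finset.card_insert_of_notMem hzC, hC], ?_⟩
    have hstep : ∑ i ∈ I, (2 : ℝ) ^ (insert z C ∩ S i).card =
        Φ + ∑ i ∈ I.filter (fun i => z ∈ S i), (2 : ℝ) ^ (C ∩ S i).card := by
      rw [hΦ, Finset.sum_filter, ← Finset.sum_add_distrib]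
      refine Finset.sum_congr rfl fun i _ => ?_
      by_cases hzi : z ∈ S i
      · rw [Finset.insert_inter_of_mem hzi, Finset.card_insert_of_notMem (by simp [hzC]), pow_succ]
        simp only [hzi, if_true]
        ring
      · rw [Finset.insert_inter_of_notMem hzi]
        simp [hzi]
    rw [hstep, pow_succ]
    have h1 : Φ + D * Φ / h₀ = Φ * (1 + (D : ℝ) / h₀) := by ring
    have h2 := mul_le_mul_of_nonneg_right hsum (show 0 ≤ 1 + (D : ℝ) / h₀ by positivity)
    linarith

end Spread

/-! ### Maker's strategy -/

section MakerSide

variable {n : ℕ}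

/-- The vertices `x` and `y` are at distance at most two in the graph with edge set `M`. -/
def WithinTwo (M : Finset (Sym2 (Fin n))) (x y : Fin n) : Prop :=
  x = y ∨ s(x, y) ∈ M ∨ ∃ z, s(x, z) ∈ M ∧ s(y, z) ∈ M

theorem WithinTwo.mono {M M' : Finset (Sym2 (Fin n))} {x y : Fin n} (h : WithinTwo M x y)
    (hM : M ⊆ M') : WithinTwo M' x y := by
  rcases h with h | h | ⟨z, h1, h2⟩
  · exact Or.inl h
  · exact Or.inr (Or.inl (hM h))
  · exact Or.inr (Or.inr ⟨z, hM h1, hM h2⟩)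

theorem WithinTwo.symm {M : Finset (Sym2 (Fin n))} {x y : Fin n} (h : WithinTwo M x y) :
    WithinTwo M y x := by
  rcases h with h | h | ⟨z, h1, h2⟩
  · exact Or.inl h.symm
  · exact Or.inr (Or.inl (Sym2.eq_swap ▸ h))
  · exact Or.inr (Or.inr ⟨z, h2, h1⟩)

theorem hasDiamAtMost_two_of_withinTwo {M : Finset (Sym2 (Fin n))}
    (hM : M ⊆ (⊤ : SimpleGraph (Fin n)).edgeFinset) (h : ∀ x y, WithinTwo M x y) :
    HasDiamAtMost n 2 M := by
  have hadj : ∀ {x y}, s(x, y) ∈ M → (SimpleGraph.fromEdgeSet (M : Set (Sym2 (Fin n)))).Adj x y :=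
    fun {x y} he => (SimpleGraph.fromEdgeSet_adj _).2 ⟨by simpa using he, mk_mem_board.1 (hM he)⟩
  refine SimpleGraph.ediam_le_of_edist_le fun x y => ?_
  rcases h x y with rfl | h | ⟨z, h1, h2⟩
  · simp
  · refine (SimpleGraph.Walk.edist_le (.cons (hadj h) .nil)).trans ?_
    norm_num
  · refine (SimpleGraph.Walk.edist_le (.cons (hadj h1) (.cons (hadj h2).symm .nil))).trans ?_
    norm_num

theorem card_inter_nbhd_le (C : Finset (Fin n)) (B B' : Finset (Sym2 (Fin n))) (y : Fin n) :
    (C ∩ nbhd B' y).card ≤ (C ∩ nbhd B y).card + (nbhd (B' \ B) y).card := by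
  refine (Finset.card_le_card fun z hz => ?_).trans (Finset.card_union_le _ _)
  simp only [Finset.mem_inter, Finset.mem_union, mem_nbhd, Finset.mem_sdiff] at hz ⊢
  tauto

/-- Maker builds a star of `r` new edges at `x` with ends in `C`, in `2 * r` rounds. -/
theorem makerWinsFrom_of_star {W : Finset (Sym2 (Fin n)) → Prop} {b β : ℕ} (hβ : 0 < β)
    (hbβ : b ≤ β) (F : Finset (Finset (Sym2 (Fin n)))) {x : Fin n} {C : Finset (Fin n)}
    (hx : x ∉ C) (r : ℕ) :
    ∀ M B N, IsPosition (⊤ : SimpleGraph (Fin n)).edgeFinset M B → N ⊆ C →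
      (∀ z ∈ N, s(x, z) ∈ M) →
      (C ∩ nbhd B x).card + N.card + (2 * β + 1) * r ≤ C.card →
      (∀ M' B' N', IsPosition (⊤ : SimpleGraph (Fin n)).edgeFinset M' B' → M ⊆ M' → B ⊆ B' →
        (B' \ B).card ≤ 2 * β * r → hitPotential (2 * β) F M' B' ≤ hitPotential (2 * β) F M B →
        N' ⊆ C → N'.card = N.card + r → (∀ z ∈ N', s(x, z) ∈ M') →
        MakerWinsFrom (⊤ : SimpleGraph (Fin n)).edgeFinset W 2 b M' B') →
      MakerWinsFrom (⊤ : SimpleGraph (Fin n)).edgeFinset W 2 b M B := by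
  induction r with
  | zero =>
    intro M B N hpos hN hNM _ hcont
    exact hcont M B N hpos le_rfl le_rfl (by simp) le_rfl hN rfl hNM
  | succ r ih =>
    intro M B N hpos hN hNM hcard hcont
    rw [mul_add_one] at hcard
    refine makerWinsFrom_of_two_rounds hβ hbβ F hpos fun M₁ B₁ hpos₁ hM₁ hB₁ hc₁ => ?_
    have hCB := (card_inter_nbhd_le C B B₁ x).trans
      (Nat.add_le_add_left ((card_nbhd_le (B₁ \ B) x).trans hc₁) _)
    -- Each pair of rounds uses up at most `2 * β` vertices of `C` through Breaker and one through
    -- Maker, hence the factor `2 * β + 1` in the hypothesis.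
    obtain ⟨z, hzC, hz⟩ : ∃ z ∈ C, z ∉ (C ∩ nbhd B₁ x) ∪ N := by
      refine Finset.exists_mem_notMem_of_card_lt_card ?_
      have := Finset.card_union_le (C ∩ nbhd B₁ x) N
      omega
    simp only [Finset.mem_union, Finset.mem_inter, hzC, true_and, mem_nbhd, not_or] at hz
    refine ⟨{s(x, z)}, ?_, by simp, fun M₂ B₂ hpos₂ hM₂ hB₂ hc₂ hpot => ?_⟩
    · refine Finset.singleton_subset_iff.2 (Finset.mem_sdiff.2 ⟨mk_mem_board.2 ?_, hz.1⟩)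
      rintro rfl
      exact hx hzC
    · have hM02 : M ⊆ M₂ := hM₁.trans (Finset.subset_union_left.trans hM₂)
      have hCB₂ := (card_inter_nbhd_le C B B₂ x).trans
        (Nat.add_le_add_left ((card_nbhd_le (B₂ \ B) x).trans hc₂) _)
      have hins : (insert z N).card = N.card + 1 := Finset.card_insert_of_notMem hz.2
      refine ih M₂ B₂ (insert z N) hpos₂ (Finset.insert_subset hzC hN) (fun w hw => ?_)
        (by omega) fun M' B' N' hp hM' hB' hc' hpot' hN' hcN' hNM' => ?_
      · rcases Finset.mem_insert.1 hw with rfl | hw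
        · exact hM₂ (Finset.mem_union_right _ (Finset.mem_singleton_self _))
        · exact hM02 (hNM w hw)
      · refine hcont M' B' N' hp (hM02.trans hM') ((hB₁.trans hB₂).trans hB') ?_
          (hpot'.trans hpot) hN' (by omega) hNM'
        have := card_sdiff_le_add hc₂ hc'
        rw [mul_add_one]
        omega

/-- Maker joins `x` to all the vertices of `Y`, taking a path of length two in a single move. -/
theorem makerWinsFrom_of_paths {W : Finset (Sym2 (Fin n)) → Prop} {b β E : ℕ} (hβ : 0 < β)
    (hbβ : b ≤ β) (hE : 2 * E + 2 < n) (F : Finset (Finset (Sym2 (Fin n)))) {x : Fin n}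
    (Y : Finset (Fin n)) (hx : x ∉ Y) :
    ∀ M B, IsPosition (⊤ : SimpleGraph (Fin n)).edgeFinset M B →
      (∀ y ∈ insert x Y, (nbhd B y).card + 2 * β * Y.card ≤ E) →
      (∀ M' B', IsPosition (⊤ : SimpleGraph (Fin n)).edgeFinset M' B' → M ⊆ M' → B ⊆ B' →
        (B' \ B).card ≤ 2 * β * Y.card →
        hitPotential (2 * β) F M' B' ≤ hitPotential (2 * β) F M B →
        (∀ y ∈ Y, WithinTwo M' x y) →
        MakerWinsFrom (⊤ : SimpleGraph (Fin n)).edgeFinset W 2 b M' B') →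
      MakerWinsFrom (⊤ : SimpleGraph (Fin n)).edgeFinset W 2 b M B := by
  induction Y using Finset.induction_on with
  | empty =>
    intro M B hpos _ hcont
    exact hcont M B hpos le_rfl le_rfl (by simp) le_rfl (by simp)
  | insert y Y hy ih =>
    intro M B hpos hdeg hcont
    rw [Finset.card_insert_of_notMem hy, mul_add_one] at hdeg hcont
    rw [Finset.mem_insert, not_or] at hx
    refine makerWinsFrom_of_two_rounds hβ hbβ F hpos fun M₁ B₁ hpos₁ hM₁ hB₁ hc₁ => ?_
    have hd : ∀ v, (nbhd B₁ v).card ≤ (nbhd B v).card + β := fun v =>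
      (card_nbhd_le_add B B₁ v).trans
        (Nat.add_le_add_left ((card_nbhd_le (B₁ \ B) v).trans hc₁) _)
    obtain ⟨z, -, hz⟩ : ∃ z ∈ (Finset.univ : Finset (Fin n)),
        z ∉ insert x (insert y (nbhd B₁ x ∪ nbhd B₁ y)) := by
      refine Finset.exists_mem_notMem_of_card_lt_card ?_
      have h1 := Finset.card_insert_le x (insert y (nbhd B₁ x ∪ nbhd B₁ y))
      have h2 := Finset.card_insert_le y (nbhd B₁ x ∪ nbhd B₁ y)
      have h3 := Finset.card_union_le (nbhd B₁ x) (nbhd B₁ y)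
      have h4 := hd x
      have h5 := hd y
      have h6 := hdeg x (by simp)
      have h7 := hdeg y (by simp)
      rw [Finset.card_univ, Fintype.card_fin]
      omega
    simp only [Finset.mem_insert, Finset.mem_union, mem_nbhd, not_or] at hz
    obtain ⟨hzx, hzy, hzBx, hzBy⟩ := hz
    refine ⟨{s(x, z), s(y, z)}, ?_, Finset.card_le_two, fun M₂ B₂ hpos₂ hM₂ hB₂ hc₂ hpot => ?_⟩
    · refine Finset.insert_subset (Finset.mem_sdiff.2 ⟨mk_mem_board.2 (Ne.symm hzx), hzBx⟩)
        (Finset.singleton_subset_iff.2 (Finset.mem_sdiff.2 ⟨mk_mem_board.2 (Ne.symm hzy), hzBy⟩))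
    · have hM02 : M ⊆ M₂ := hM₁.trans (Finset.subset_union_left.trans hM₂)
      have hxy : WithinTwo M₂ x y := Or.inr (Or.inr ⟨z,
        hM₂ (Finset.mem_union_right _ (by simp)), hM₂ (Finset.mem_union_right _ (by simp))⟩)
      refine ih hx.2 M₂ B₂ hpos₂ (fun v hv => ?_) fun M' B' hp hM' hB' hc' hpot' hJ => ?_
      · have h1 := hdeg v (by
          rcases Finset.mem_insert.1 hv with rfl | hv
          · simp
          · simp [hv])
        have h2 := card_nbhd_le_add B B₂ v
        have h3 := (card_nbhd_le (B₂ \ B) v).trans hc₂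
        omega
      · refine hcont M' B' hp (hM02.trans hM') ((hB₁.trans hB₂).trans hB') ?_
          (hpot'.trans hpot) fun v hv => ?_
        · have := card_sdiff_le_add hc₂ hc'
          omega
        · rcases Finset.mem_insert.1 hv with rfl | hv
          · exact hxy.mono hM'
          · exact hJ v hv

theorem hitWeight_le_inv_four_pow {α : Type*} [DecidableEq α] {β l : ℕ} (hβ : 0 < β)
    {A B : Finset α} (h : 4 * β * l ≤ (A \ B).card) :
    hitWeight (2 * β) B A ≤ ((4 : ℝ) ^ l)⁻¹ := by
  have hβ' : (0 : ℝ) < β := by exact_mod_cast hβ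
  have h1 : ((4 : ℝ) ^ l)⁻¹ = (2 : ℝ) ^ (-((2 * l : ℕ) : ℝ)) := by
    rw [Real.rpow_neg (by norm_num), Real.rpow_natCast, pow_mul]
    norm_num
  rw [h1, hitWeight]
  refine Real.rpow_le_rpow_of_exponent_le (by norm_num) (neg_le_neg ?_)
  rw [le_div_iff₀ (by positivity)]
  have : ((4 * β * l : ℕ) : ℝ) ≤ (A \ B).card := by exact_mod_cast h
  push_cast at this ⊢
  linarith

/-- A set of `m` vertices outside `Z` meeting each of the sets `S i` in at most `l` vertices. -/
theorem exists_spread_avoiding {l D m : ℕ} (hm : 0 < m) (hD : 0 < D) (hl : n < 2 ^ l)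
    (U : Finset (Fin n)) (S : Fin n → Finset (Fin n)) (hS : ∀ i ∈ U, (S i).card ≤ D)
    (Z : Finset (Fin n)) (hZ : Z.card + 2 * m * D + m ≤ n) :
    ∃ C : Finset (Fin n), Disjoint C Z ∧ C.card = m ∧ ∀ i ∈ U, (C ∩ S i).card ≤ l := by
  have hcard : (Finset.univ \ Z).card = n - Z.card := by
    rw [Finset.card_sdiff_of_subset (Finset.subset_univ _)]
    simp
  obtain ⟨C, hCZ, hC, hsum⟩ := exists_spread_subset U S hS (h₀ := 2 * m * D) (by positivity)
    (Finset.univ \ Z) m (by omega)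
  refine ⟨C, Finset.disjoint_of_subset_left hCZ Finset.sdiff_disjoint, hC, fun i hi => ?_⟩
  have hm' : (0 : ℝ) < m := by exact_mod_cast hm
  have hD' : (0 : ℝ) < D := by exact_mod_cast hD
  -- Keeping `2 * m * D` candidates at every step limits the growth to (1 + 1/(2m))^m ≤ e^(1/2) ≤ 2,
  -- so each 2^|C ∩ S i| is at most 2n < 2^(l+1).
  have hpow : (1 + (D : ℝ) / (2 * m * D : ℕ)) ^ m ≤ 2 := by
    have h1 : (D : ℝ) / (2 * m * D : ℕ) = 1 / (2 * m) := by
      push_cast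
      field_simp
    have h2 : 1 + 1 / (2 * (m : ℝ)) ≤ Real.exp (1 / (2 * m)) := by
      have := Real.add_one_le_exp (1 / (2 * (m : ℝ)))
      linarith
    rw [h1]
    calc (1 + 1 / (2 * (m : ℝ))) ^ m ≤ Real.exp (1 / (2 * m)) ^ m :=
          pow_le_pow_left₀ (by positivity) h2 m
      _ = Real.exp (1 / 2) := by
          rw [← Real.exp_nat_mul]
          congr 1
          field_simp
      _ ≤ Real.exp (Real.log 2) := by
          have := Real.log_two_gt_d9
          exact Real.exp_le_exp.2 (by linarith)
      _ = 2 := Real.exp_log (by norm_num)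
  have hU : (U.card : ℝ) ≤ n := by
    exact_mod_cast (by simpa using Finset.card_le_univ U : U.card ≤ n)
  have h1 : (2 : ℝ) ^ (C ∩ S i).card ≤ n * 2 :=
    (Finset.single_le_sum (f := fun i => (2 : ℝ) ^ (C ∩ S i).card)
      (fun i _ => by positivity) hi).trans (hsum.trans
        (mul_le_mul hU hpow (by positivity) (by positivity)))
  have h2 : 2 ^ (C ∩ S i).card < 2 ^ (l + 1) := by
    have h3 : 2 ^ (C ∩ S i).card ≤ n * 2 := by exact_mod_cast h1
    rw [pow_succ]
    omega
  have := (Nat.pow_lt_pow_iff_right (by norm_num)).1 h2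
  omega

/-- The number of edges that Breaker takes while Maker processes one vertex. -/
def processCost (β l : ℕ) : ℕ := 2 * β * (8 * β * l) + 2 * β * (16 * β)

/-- The first bound is the room needed to choose C, the second the room for a common neighbour in a
path. With Q = β²l, the dominant term is at most 2 · 24Q · 96Ql = 4608β⁴l³, whence the 5000. -/
theorem process_bounds {β l : ℕ} (hβ : 0 < β) (hl : 0 < l) (h : 5000 * β ^ 4 * l ^ 3 ≤ n) :
    1 + 2 * processCost β l * l + 2 * ((2 * β + 1) * (8 * β * l)) * (2 * processCost β l * l) +
      (2 * β + 1) * (8 * β * l) ≤ n ∧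
    2 * (2 * processCost β l * l + processCost β l) + 2 < n := by
  obtain ⟨Q, hQ⟩ : ∃ Q, Q = β ^ 2 * l := ⟨_, rfl⟩
  have hQ1 : 1 ≤ Q := by
    rw [hQ]
    exact Nat.succ_le_of_lt (by positivity)
  have hL : processCost β l ≤ 48 * Q := by
    have : β ^ 2 * 1 ≤ β ^ 2 * l := Nat.mul_le_mul_left _ hl
    rw [processCost, hQ]
    nlinarith
  have hm : (2 * β + 1) * (8 * β * l) ≤ 24 * Q := by
    have : β * l * 1 ≤ β * l * β := Nat.mul_le_mul_left _ hβ
    rw [hQ]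
    nlinarith
  have hD : 2 * processCost β l * l ≤ 96 * (Q * l) := by nlinarith
  have hR : 5000 * (Q * (Q * l)) ≤ n := by
    refine le_trans (le_of_eq ?_) h
    rw [hQ]
    ring
  have hQl : Q ≤ Q * l := Nat.le_mul_of_pos_right _ hl
  have hQQ : Q * l ≤ Q * (Q * l) := Nat.le_mul_of_pos_left _ hQ1
  have hmD := Nat.mul_le_mul hm hD
  have e : 24 * Q * (96 * (Q * l)) = 2304 * (Q * (Q * l)) := by ring
  rw [e] at hmD
  constructor
  · rw [mul_assoc 2 ((2 * β + 1) * (8 * β * l))]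
    omega
  · omega

/-- Maker processes the vertex `x`: afterwards each pair `x`, `y` with `y ∈ U` is joined, or it
will be as soon as Maker hits a certain set of the family. -/
theorem makerWinsFrom_of_process {W : Finset (Sym2 (Fin n)) → Prop} {b β l : ℕ} (hβ : 0 < β)
    (hbβ : b ≤ β) (hl : 0 < l) (hnl : n < 2 ^ l) (hn : 5000 * β ^ 4 * l ^ 3 ≤ n)
    (F : Finset (Finset (Sym2 (Fin n)))) {x : Fin n} {U : Finset (Fin n)} (hxU : x ∈ U)
    {M B : Finset (Sym2 (Fin n))} (hpos : IsPosition (⊤ : SimpleGraph (Fin n)).edgeFinset M B)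
    (hdeg : ∀ y ∈ U, (nbhd B y).card ≤ 2 * processCost β l * l)
    (hcont : ∀ M' B' G, IsPosition (⊤ : SimpleGraph (Fin n)).edgeFinset M' B' → M ⊆ M' → B ⊆ B' →
      (B' \ B).card ≤ processCost β l → (∀ A ∈ G, A ⊆ (⊤ : SimpleGraph (Fin n)).edgeFinset) →
      (∀ y ∈ U, WithinTwo M' x y ∨ ∃ A ∈ G, ∀ e ∈ A, WithinTwo (insert e M') x y) →
      hitPotential (2 * β) (F ∪ G) M' B' ≤ hitPotential (2 * β) F M B + n * ((4 : ℝ) ^ l)⁻¹ →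
      MakerWinsFrom (⊤ : SimpleGraph (Fin n)).edgeFinset W 2 b M' B') :
    MakerWinsFrom (⊤ : SimpleGraph (Fin n)).edgeFinset W 2 b M B := by
  obtain ⟨hb1, hb2⟩ := process_bounds hβ hl hn
  set D := 2 * processCost β l * l with hD
  have hcost : 0 < processCost β l := by
    unfold processCost
    positivity
  obtain ⟨C, hCZ, hC, hCU⟩ := exists_spread_avoiding (n := n) (l := l) (D := D)
    (m := (2 * β + 1) * (8 * β * l)) (by positivity) (by positivity) hnl U (nbhd B) hdeg
    (insert x (nbhd B x)) (by
      have := Finset.card_insert_le x (nbhd B x)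
      have := hdeg x hxU
      omega)
  rw [Finset.disjoint_insert_right] at hCZ
  refine makerWinsFrom_of_star hβ hbβ F hCZ.1 (8 * β * l) M B ∅ hpos (by simp) (by simp)
    (by rw [Finset.disjoint_iff_inter_eq_empty.1 hCZ.2, hC]; simp)
    fun M₁ B₁ N hpos₁ hM₁ hB₁ hc₁ hpot₁ hNC hN hNM => ?_
  rw [Finset.card_empty, zero_add] at hN
  -- The threshold is half of |N| = 8βl.
  set Bad := (U.erase x).filter (fun y => 4 * β * l ≤ (N ∩ nbhd B₁ y).card) with hBad
  have hBadU : ∀ y ∈ Bad, y ∈ U := fun y hy =>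
    Finset.mem_of_mem_erase (Finset.mem_filter.1 hy).1
  -- At most `l` of the Breaker edges from a bad vertex to `N` are old, so at least `2 * β * l` were
  -- taken while the star was built. Breaker then took at most `2 * β * (8 * β * l)` edges, each
  -- counted at most twice.
  have hBadc : Bad.card ≤ 16 * β := by
    have h1 : ∀ y ∈ Bad, 2 * β * l ≤ (nbhd (B₁ \ B) y).card := by
      intro y hy
      have h2 := card_inter_nbhd_le N B B₁ y
      have h3 := (Finset.card_le_card (Finset.inter_subset_inter_right hNC)).trans
        (hCU y (hBadU y hy))
      have h4 := (Finset.mem_filter.1 hy).2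
      have h5 : 1 * l ≤ β * l := Nat.mul_le_mul_right _ hβ
      have h6 : 4 * β * l = 4 * (β * l) := by ring
      have h7 : 2 * β * l = 2 * (β * l) := by ring
      omega
    have h2 : Bad.card * (2 * β * l) ≤ 2 * (2 * β * (8 * β * l)) := by
      calc Bad.card * (2 * β * l) ≤ ∑ y ∈ Bad, (nbhd (B₁ \ B) y).card := by
            simpa using Finset.card_nsmul_le_sum Bad _ _ h1
        _ ≤ ∑ y, (nbhd (B₁ \ B) y).card :=
            Finset.sum_le_sum_of_subset (Finset.subset_univ _)
        _ ≤ 2 * (B₁ \ B).card := sum_card_nbhd_le _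
        _ ≤ 2 * (2 * β * (8 * β * l)) := Nat.mul_le_mul_left _ hc₁
    refine Nat.le_of_mul_le_mul_right (c := 2 * β * l) (h2.trans (le_of_eq ?_)) (by positivity)
    ring
  set Good := (U.erase x).filter (fun y => y ∉ Bad ∧ y ∉ N) with hGood
  set G := Good.image (fun y => N.image fun z => s(y, z)) with hG
  have hGX : ∀ A ∈ G, A ⊆ (⊤ : SimpleGraph (Fin n)).edgeFinset := by
    intro A hA
    obtain ⟨y, hy, rfl⟩ := Finset.mem_image.1 hA
    refine Finset.image_subset_iff.2 fun z hz => mk_mem_board.2 ?_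
    rintro rfl
    exact (Finset.mem_filter.1 hy).2.2 hz
  have hGw : ∑ A ∈ G, hitWeight (2 * β) B₁ A ≤ n * ((4 : ℝ) ^ l)⁻¹ := by
    have h1 : ∀ A ∈ G, hitWeight (2 * β) B₁ A ≤ ((4 : ℝ) ^ l)⁻¹ := by
      intro A hA
      obtain ⟨y, hy, rfl⟩ := Finset.mem_image.1 hA
      obtain ⟨hyU, hyBad, -⟩ := Finset.mem_filter.1 hy
      -- More than `4 * β * l` elements of the set remain outside `B₁`; with `K = 2 * β` this gives
      -- weight at most 4^(-l).
      have h2 : (N ∩ nbhd B₁ y).card < 4 * β * l := by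
        by_contra hcon
        exact hyBad (Finset.mem_filter.2 ⟨hyU, not_lt.1 hcon⟩)
      have h3 := Finset.card_sdiff_add_card_inter N (nbhd B₁ y)
      have h4 : (N \ nbhd B₁ y).card ≤ ((N.image fun z => s(y, z)) \ B₁).card := by
        refine Finset.card_le_card_of_injOn (fun z => s(y, z)) (fun z hz => ?_)
          (mk_right_injective y).injOn
        have hz' := Finset.mem_sdiff.1 hz
        exact Finset.mem_sdiff.2 ⟨Finset.mem_image_of_mem _ hz'.1, fun h => hz'.2 (mem_nbhd.2 h)⟩
      refine hitWeight_le_inv_four_pow hβ ?_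
      have h5 : 8 * β * l = 2 * (4 * β * l) := by ring
      omega
    have h2 : (G.card : ℝ) ≤ n := by
      exact_mod_cast (Finset.card_image_le.trans
        (by simpa using Finset.card_le_univ Good : Good.card ≤ n))
    refine (Finset.sum_le_card_nsmul G _ _ h1).trans ?_
    rw [nsmul_eq_mul]
    exact mul_le_mul_of_nonneg_right h2 (by positivity)
  have hpotG : hitPotential (2 * β) (F ∪ G) M₁ B₁ ≤
      hitPotential (2 * β) F M B + n * ((4 : ℝ) ^ l)⁻¹ :=
    (hitPotential_union_le _ _ _ _ _).trans (add_le_add hpot₁ hGw)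
  have hBadcost : 2 * β * (8 * β * l) + 2 * β * Bad.card ≤ processCost β l :=
    Nat.add_le_add_left (Nat.mul_le_mul_left _ hBadc) _
  have hxBad : x ∉ Bad := fun h => Finset.notMem_erase x U (Finset.mem_filter.1 h).1
  refine makerWinsFrom_of_paths hβ hbβ hb2 (F ∪ G) Bad hxBad M₁ B₁ hpos₁
    (fun y hy => ?_) fun M₂ B₂ hpos₂ hM₂ hB₂ hc₂ hpot₂ hJ => ?_
  · have hyU : y ∈ U := by
      rcases Finset.mem_insert.1 hy with rfl | hy
      · exact hxU
      · exact hBadU y hy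
    have h1 := hdeg y hyU
    have h2 := card_nbhd_le_add B B₁ y
    have h3 := (card_nbhd_le (B₁ \ B) y).trans hc₁
    omega
  · refine hcont M₂ B₂ G hpos₂ (hM₁.trans hM₂) (hB₁.trans hB₂)
      ((card_sdiff_le_add hc₁ hc₂).trans hBadcost) hGX (fun y hy => ?_) (hpot₂.trans hpotG)
    by_cases hyx : y = x
    · exact Or.inl (Or.inl hyx.symm)
    by_cases hyN : y ∈ N
    · exact Or.inl (Or.inr (Or.inl (hM₂ (hNM y hyN))))
    by_cases hyB : y ∈ Bad
    · exact Or.inl (hJ y hyB)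
    refine Or.inr ⟨_, Finset.mem_image_of_mem _ (Finset.mem_filter.2
      ⟨Finset.mem_erase.2 ⟨hyx, hy⟩, hyB, hyN⟩), fun e he => ?_⟩
    obtain ⟨z, hz, rfl⟩ := Finset.mem_image.1 he
    exact Or.inr (Or.inr ⟨z, Finset.mem_insert_of_mem (hM₂ (hNM z hz)),
      Finset.mem_insert_self _ _⟩)

/-- Maker processes the vertices of `U` one after another, by decreasing degree in Breaker's
graph, and then hits the remaining sets. -/
theorem makerWinsFrom_of_unprocessed {b β l : ℕ} (hβ : 0 < β) (hbβ : b ≤ β) (hl : 0 < l)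
    (hnl : n < 2 ^ l) (hn : 5000 * β ^ 4 * l ^ 3 ≤ n) (k : ℕ) :
    ∀ (U : Finset (Fin n)) M B (F : Finset (Finset (Sym2 (Fin n)))), U.card = k →
      IsPosition (⊤ : SimpleGraph (Fin n)).edgeFinset M B →
      ∑ y ∈ U, (2 : ℝ) ^ (((nbhd B y).card : ℝ) / (2 * processCost β l : ℕ)) ≤ n →
      (∀ A ∈ F, A ⊆ (⊤ : SimpleGraph (Fin n)).edgeFinset) →
      (∀ x ∉ U, ∀ y, WithinTwo M x y ∨ ∃ A ∈ F, ∀ e ∈ A, WithinTwo (insert e M) x y) →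
      hitPotential (2 * β) F M B + k * (n * ((4 : ℝ) ^ l)⁻¹) < 1 →
      MakerWinsFrom (⊤ : SimpleGraph (Fin n)).edgeFinset (HasDiamAtMost n 2) 2 b M B := by
  have hcost : 0 < processCost β l := by
    unfold processCost
    positivity
  induction k with
  | zero =>
    intro U M B F hU hpos _ hF hJ hpot
    rw [Finset.card_eq_zero] at hU
    subst hU
    refine makerWinsFrom_of_hitPotential_lt_one (K := 2 * β) (by omega) (by omega) F hpos
      (by simpa using hpot) hF fun M' hM hX hhit => ?_
    refine hasDiamAtMost_two_of_withinTwo hX fun x y => ?_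
    rcases hJ x (by simp) y with h | ⟨A, hA, h⟩
    · exact h.mono hM
    · obtain ⟨e, heA, heM⟩ := Finset.not_disjoint_iff.1 (hhit A hA)
      exact (h e heA).mono (Finset.insert_subset heM hM)
  | succ k ih =>
    intro U M B F hU hpos hsum hF hJ hpot
    set c := processCost β l with hc
    obtain ⟨x, hxU, hmax⟩ := U.exists_max_image (fun y => (nbhd B y).card)
      (Finset.card_pos.1 (by omega))
    have hc' : (0 : ℝ) < (2 * c : ℕ) := by exact_mod_cast (by omega : 0 < 2 * c)
    set w : Fin n → ℝ := fun y => (2 : ℝ) ^ (((nbhd B y).card : ℝ) / (2 * c : ℕ)) with hw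
    have hw0 : ∀ y, 0 < w y := fun y => Real.rpow_pos_of_pos (by norm_num) _
    -- A single term of the degree potential is at most n < 2^l.
    have hdeg : ∀ y ∈ U, (nbhd B y).card ≤ 2 * c * l := by
      intro y hy
      have h1 : w y < (2 : ℝ) ^ (l : ℝ) := by
        rw [Real.rpow_natCast]
        refine ((Finset.single_le_sum (fun y _ => (hw0 y).le) hy).trans hsum).trans_lt ?_
        exact_mod_cast hnl
      have h2 := (Real.rpow_lt_rpow_left_iff (by norm_num)).1 h1
      rw [div_lt_iff₀ hc', mul_comm] at h2
      exact_mod_cast h2.le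
    refine makerWinsFrom_of_process hβ hbβ hl hnl hn F hxU hpos hdeg
      fun M' B' G hpos' hM hB hcB hG hJ' hpot' => ?_
    refine ih (U.erase x) M' B' (F ∪ G) (by rw [Finset.card_erase_of_mem hxU]; omega) hpos' ?_
      (fun A hA => (Finset.mem_union.1 hA).elim (hF A) (hG A)) ?_ ?_
    -- The new degrees total at most `2 * c`, and no weight in `U` exceeds `w x`, so the potential
    -- grows by at most `w x`. Dropping `x` from `U` pays for that.
    · refine le_trans ?_ hsum
      have h1 : ∀ y ∈ U.erase x, (2 : ℝ) ^ (((nbhd B' y).card : ℝ) / (2 * c : ℕ)) ≤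
          w y + w x * ((nbhd (B' \ B) y).card / (2 * c : ℕ)) := by
        intro y hy
        have h2 : ((nbhd B' y).card : ℝ) / (2 * c : ℕ) ≤
            (nbhd B y).card / (2 * c : ℕ) + (nbhd (B' \ B) y).card / (2 * c : ℕ) := by
          rw [← add_div]
          refine div_le_div_of_nonneg_right ?_ hc'.le
          exact_mod_cast card_nbhd_le_add B B' y
        have h3 : (nbhd (B' \ B) y).card ≤ 2 * c := by
          have := (card_nbhd_le (B' \ B) y).trans hcB
          omega
        have h4 : w y ≤ w x := by
          refine Real.rpow_le_rpow_of_exponent_le (by norm_num)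
            (div_le_div_of_nonneg_right ?_ hc'.le)
          exact_mod_cast hmax y (Finset.mem_of_mem_erase hy)
        calc (2 : ℝ) ^ (((nbhd B' y).card : ℝ) / (2 * c : ℕ))
            ≤ w y * (2 : ℝ) ^ (((nbhd (B' \ B) y).card : ℝ) / (2 * c : ℕ)) := by
              rw [hw, ← Real.rpow_add (by norm_num)]
              exact Real.rpow_le_rpow_of_exponent_le (by norm_num) h2
          _ ≤ w y * (1 + (nbhd (B' \ B) y).card / (2 * c : ℕ)) :=
              mul_le_mul_of_nonneg_left (two_rpow_div_le h3) (hw0 y).le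
          _ ≤ w y + w x * ((nbhd (B' \ B) y).card / (2 * c : ℕ)) := by
              rw [mul_add, mul_one]
              exact add_le_add le_rfl (mul_le_mul_of_nonneg_right h4 (by positivity))
      refine (Finset.sum_le_sum h1).trans ?_
      rw [Finset.sum_add_distrib, ← Finset.mul_sum, ← Finset.sum_div,
        ← Finset.add_sum_erase U w hxU, add_comm]
      refine add_le_add (mul_le_of_le_one_right (hw0 x).le ((div_le_one hc').2 ?_)) le_rfl
      have h2 : ∑ y ∈ U.erase x, (nbhd (B' \ B) y).card ≤ 2 * c :=
        (Finset.sum_le_sum_of_subset (Finset.subset_univ _)).trans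
          ((sum_card_nbhd_le _).trans (Nat.mul_le_mul_left 2 hcB))
      exact_mod_cast h2
    · have hold : ∀ v ∉ U, ∀ y, WithinTwo M' v y ∨
          ∃ A ∈ F ∪ G, ∀ e ∈ A, WithinTwo (insert e M') v y := by
        intro v hv y
        rcases hJ v hv y with h | ⟨A, hA, h⟩
        · exact Or.inl (h.mono hM)
        · exact Or.inr ⟨A, Finset.mem_union_left _ hA, fun e he =>
            (h e he).mono (Finset.insert_subset_insert e hM)⟩
      intro v hv y
      by_cases hvU : v ∈ U
      · have hvx : v = x := by
          by_contra hne
          exact hv (Finset.mem_erase.2 ⟨hne, hvU⟩)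
        subst hvx
        by_cases hyU : y ∈ U
        · rcases hJ' y hyU with h | ⟨A, hA, h⟩
          · exact Or.inl h
          · exact Or.inr ⟨A, Finset.mem_union_right _ hA, h⟩
        -- If `y` was processed earlier, the pair was dealt with then, and the relation is
        -- symmetric.
        · rcases hold y hyU v with h | ⟨A, hA, h⟩
          · exact Or.inl h.symm
          · exact Or.inr ⟨A, hA, fun e he => (h e he).symm⟩
      · exact hold v hvU y
    · push_cast at hpot
      linarith

theorem makerWinsDiameterGame_two_of_bound {b l : ℕ} (hl : 0 < l) (hnl : n < 2 ^ l)
    (hn : 5000 * (b + 1) ^ 4 * l ^ 3 ≤ n) : MakerWinsDiameterGame n 2 2 b := by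
  -- `b + 1` rather than `b` keeps `β` positive even if the bias is zero.
  refine makerWinsFrom_of_unprocessed (β := b + 1) (by omega) (by omega) hl hnl hn n
    Finset.univ ∅ ∅ ∅ (by simp) ⟨by simp, by simp, by simp⟩ (by simp [nbhd]) (by simp) (by simp) ?_
  have h1 : (n : ℝ) < 2 ^ l := by exact_mod_cast hnl
  have h2 : (n : ℝ) * n < 4 ^ l := by
    have h3 : (4 : ℝ) ^ l = 2 ^ l * 2 ^ l := by
      rw [← mul_pow]
      norm_num
    rw [h3]
    exact mul_lt_mul'' h1 h1 (by positivity) (by positivity)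
  have h4 : hitPotential (2 * (b + 1)) (∅ : Finset (Finset (Sym2 (Fin n)))) ∅ ∅ = 0 := by
    simp [hitPotential]
  rw [h4, zero_add, ← mul_assoc, ← div_eq_mul_inv, div_lt_one (by positivity)]
  exact h2

/-- Crude estimates suffice: (b+1)⁴ and l³ are each at most a constant times √n, the constants being
16 and (3/200)³. -/
theorem eventually_makerWinsDiameterGame_two :
    ∀ᶠ n : ℕ in atTop, MakerWinsDiameterGame n 2 2
      ⌊(1 / 9 : ℝ) * (n : ℝ) ^ (1 / 8 : ℝ) / (Real.log (n : ℝ)) ^ (3 / 8 : ℝ)⌋₊ := by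
  have hlog : ∀ᶠ n : ℕ in atTop, Real.log (n : ℝ) ≤ 1 / 200 * (n : ℝ) ^ (1 / 6 : ℝ) := by
    have h1 := (isLittleO_log_rpow_atTop (show (0 : ℝ) < 1 / 6 by norm_num)).bound
      (show (0 : ℝ) < 1 / 200 by norm_num)
    filter_upwards [tendsto_natCast_atTop_atTop.eventually h1] with n hn
    refine (le_abs_self _).trans ?_
    rwa [Real.norm_eq_abs, Real.norm_of_nonneg (by positivity)] at hn
  have hlog1 : ∀ᶠ n : ℕ in atTop, 1 ≤ Real.log (n : ℝ) :=
    (Real.tendsto_log_atTop.comp tendsto_natCast_atTop_atTop).eventually_ge_atTop 1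
  filter_upwards [hlog, hlog1, eventually_ge_atTop 1] with n hn hn1 hn0
  set b := ⌊(1 / 9 : ℝ) * (n : ℝ) ^ (1 / 8 : ℝ) / (Real.log (n : ℝ)) ^ (3 / 8 : ℝ)⌋₊ with hb
  refine makerWinsDiameterGame_two_of_bound (l := Nat.log 2 n + 1) (by omega)
    (Nat.lt_pow_succ_log_self (by norm_num) n) ?_
  have hn0' : (1 : ℝ) ≤ n := by exact_mod_cast hn0
  have hx1 : 1 ≤ (n : ℝ) ^ (1 / 8 : ℝ) := Real.one_le_rpow hn0' (by norm_num)
  have hbx : (b : ℝ) + 1 ≤ 2 * (n : ℝ) ^ (1 / 8 : ℝ) := by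
    have h1 : (b : ℝ) ≤ (1 / 9 : ℝ) * (n : ℝ) ^ (1 / 8 : ℝ) / (Real.log (n : ℝ)) ^ (3 / 8 : ℝ) :=
      Nat.floor_le (by positivity)
    have h2 : (1 / 9 : ℝ) * (n : ℝ) ^ (1 / 8 : ℝ) / (Real.log (n : ℝ)) ^ (3 / 8 : ℝ) ≤
        (1 / 9 : ℝ) * (n : ℝ) ^ (1 / 8 : ℝ) :=
      div_le_self (by positivity) (Real.one_le_rpow hn1 (by norm_num))
    linarith
  have hl : ((Nat.log 2 n + 1 : ℕ) : ℝ) ≤ 3 / 200 * (n : ℝ) ^ (1 / 6 : ℝ) := by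
    have h1 : (Nat.log 2 n : ℝ) * Real.log 2 ≤ Real.log n := by
      rw [← Real.log_pow]
      refine Real.log_le_log (by positivity) ?_
      exact_mod_cast Nat.pow_log_le_self 2 (by omega)
    have h2 := Real.log_two_gt_d9
    have h3 : (Nat.log 2 n : ℝ) * (1 / 2) ≤ Nat.log 2 n * Real.log 2 :=
      mul_le_mul_of_nonneg_left (by linarith) (by positivity)
    push_cast
    linarith
  have h4 : ((b : ℝ) + 1) ^ 4 ≤ 16 * (n : ℝ) ^ (1 / 2 : ℝ) := by
    refine (pow_le_pow_left₀ (by positivity) hbx 4).trans (le_of_eq ?_)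
    rw [mul_pow, ← Real.rpow_natCast ((n : ℝ) ^ (1 / 8 : ℝ)), ← Real.rpow_mul (by positivity)]
    norm_num
  have h5 : ((Nat.log 2 n + 1 : ℕ) : ℝ) ^ 3 ≤ (3 / 200) ^ 3 * (n : ℝ) ^ (1 / 2 : ℝ) := by
    refine (pow_le_pow_left₀ (by positivity) hl 3).trans (le_of_eq ?_)
    rw [mul_pow, ← Real.rpow_natCast ((n : ℝ) ^ (1 / 6 : ℝ)), ← Real.rpow_mul (by positivity)]
    norm_num
  have h6 : (n : ℝ) ^ (1 / 2 : ℝ) * (n : ℝ) ^ (1 / 2 : ℝ) = n := by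
    rw [← Real.rpow_add (by linarith)]
    norm_num
  have h7 := mul_le_mul h4 h5 (by positivity) (by positivity)
  have h8 : 5000 * ((b : ℝ) + 1) ^ 4 * ((Nat.log 2 n + 1 : ℕ) : ℝ) ^ 3 ≤ n := by
    nlinarith
  exact_mod_cast h8

end MakerSide

theorem mainTheorem1 :
    (∀ᶠ n : ℕ in atTop,
      MakerWinsDiameterGame n 2 2
        ⌊(1 / 9 : ℝ) * (n : ℝ) ^ (1 / 8 : ℝ) / (Real.log (n : ℝ)) ^ (3 / 8 : ℝ)⌋₊) ∧
    (∀ ε : ℝ, 0 < ε → ∀ᶠ n : ℕ in atTop,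
      BreakerWinsDiameterGame n 2 2
        ⌊(2 + ε) * Real.sqrt ((n : ℝ) / Real.log (n : ℝ))⌋₊) :=
  ⟨eventually_makerWinsDiameterGame_two, fun _ hε => eventually_breakerWinsDiameterGame_two hε⟩
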